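/- **Setting.** Let $\Gamma_1,\dots,\Gamma_N$ be nonzero real vorticities and write $x_{jk}=x_k-x_j$. A *complex normalized central configuration* of the planar $N$-vortex problem with multiplier $\Lambda\in\mathbb C$, $|\Lambda|=1$ (real $\Lambda$ corresponding to relative equilibria, non-real $\Lambda$ to collapse configurations) is a solution $(\mathcal Z,\mathcal W)$, $$\mathcal Z=(z_1,\dots,z_N,Z_{12},\dots,Z_{(N-1)N}),\qquad \mathcal W=(w_1,\dots,w_N,W_{12},\dots,W_{(N-1)N})$$ with complex entries, of the system $$\Lambda z_n=\sum_{j\ne n}\Gamma_jZ_{jn},\quad \overline{\Lambda}\,w_n=\sum_{j\neq n}\Gamma_jW_{jn},\quad Z_{jk}w_{jk}=1,\quad W_{jk}z_{jk}=1\ (j\neq k),$$ $$Z_{jk}=-Z_{kj},\quad W_{jk}=-W_{kj},\qquad \|\mathcal Z\|=\|\mathcal W\|,$$ where $\|\cdot\|$ is the maximal modulus of a component. A *singular sequence* is a sequence of such solutions $(\mathcal Z^{(n)},\mathcal W^{(n)})$ (with multipliers $\Lambda_n$, $|\Lambda_n|=1$, in particular possibly with constant $\Lambda_n=\Lambda$)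 such that $\|\mathcal Z^{(n)}\|=\|\mathcal W^{(n)}\|\to\infty$, the index of a component of maximal modulus of $\mathcal Z^{(n)}$ can be chosen independently of $n$, likewise for $\mathcal W^{(n)}$, and the sequences $\mathcal Z^{(n)}/\|\mathcal Z^{(n)}\|$ and $\mathcal W^{(n)}/\|\mathcal W^{(n)}\|$ converge. Put $\|\mathcal Z^{(n)}\|=\|\mathcal W^{(n)}\|=\epsilon^{-2}$ and write $a\approx b$ if $a/b$ and $b/a$ are bounded for large $n$. The *two-colored diagram* of a singular sequence has the vertices (vortices), a $z$-circle at $k$ iff $z_k\approx\epsilon^{-2}$, a $z$-stroke between $j\ne k$ iff $Z_{jk}\approx\epsilon^{-2}$, a $w$-circle at $k$ iff $w_k\approx\epsilon^{-2}$, and a $w$-stroke between $j\neq k$ iff $W_{jk}\approx\epsilon^{-2}$. A vertex is *bicolored* if strokes of both colors emanate from it; $C$ is the maximal number of strokes (of both colors together) emanating from a bicolored vertex, with $C=0$ if there is none. Two diagrams are *equivalent* if one is obtained from the other by renumbering the vertices and possibly exchanging the two colors. **Notation for diagrams on five vertices, labeled $0,1,2,3,4$.** $(\pi_z\mid\pi_w\mid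 c_z\mid c_w)$ denotes the diagram in which two distinct vertices are joined by a $z$-stroke iff they lie in a common member of the list $\pi_z$, by a $w$-stroke iff they lie in a common member of $\pi_w$, and whose $z$-circled (resp. $w$-circled) vertices are those of $c_z$ (resp. $c_w$); sets are written as strings of labels. **Theorem.** Let $N=5$. The following 31 diagrams - $C=0$: $(34\mid 12\mid 34\mid 12)$; $(34\mid 012\mid 34\mid \emptyset)$; $(34\mid 012\mid 34\mid 01)$; $(34\mid 012\mid 34\mid 012)$. - $C=2$: $(12,34\mid 13,24\mid 1234\mid 1234)$. - $C=4$: $(234\mid 234\mid \emptyset\mid \emptyset)$; $(234\mid 01,234\mid \emptyset\mid 01)$; $(01,234\mid 01,234\mid 01234\mid 01234)$; $(234\mid 123\mid \emptyset\mid \emptyset)$; $(234\mid 02,134\mid \emptyset\mid 01234)$; $(01,234\mid 02,134\mid 01234\mid 01234)$; $(234\mid 012\mid \emptyset\mid \emptyset)$; $(234\mid 012\mid \emptyset\mid 01)$; $(234\mid 012\mid 34\mid 01)$; $(01,234\mid 012,34\mid 01234\mid 01234)$. - $C=5$: $(234\mid 1234\mid \emptyset\mid 1234)$; $(1234\mid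 01,234\mid 234\mid 01234)$; $(234\mid 0123\mid \emptyset\mid \emptyset)$; $(234\mid 0123\mid \emptyset\mid 01)$; $(1234\mid 012,34\mid \emptyset\mid 01234)$. - $C=6$: $(1234\mid 1234\mid \emptyset\mid \emptyset)$; $(234\mid 01234\mid \emptyset\mid 0234)$; $(234\mid 01234\mid \emptyset\mid 01234)$; $(234\mid 01234\mid \emptyset\mid \emptyset)$; $(234\mid 01234\mid \emptyset\mid 01)$; $(01,234\mid 01234\mid 01234\mid 234)$; $(01,234\mid 01234\mid 01234\mid 01234)$; $(1234\mid 0123\mid \emptyset\mid \emptyset)$. - $C=7$: $(1234\mid 01234\mid \emptyset\mid 01234)$. - $C=8$: $(01234\mid 01234\mid \emptyset\mid \emptyset)$; $(01234\mid 01234\mid 01234\mid 01234)$. together with the following 8 diagrams - $(12,34\mid 12,34\mid 1234\mid 1234)$; $(234\mid 12,34\mid \emptyset\mid 1234)$; $(234\mid 12,34\mid 34\mid 1234)$; $(234\mid 234\mid 234\mid 234)$; $(234\mid 01,234\mid 234\mid 01234)$; $(12,34\mid 1234\mid 1234\mid 1234)$; $(1234\mid 012,34\mid \emptyset\mid 1234)$;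 $(1234\mid 1234\mid 1234\mid 1234)$ are 39 pairwise inequivalent diagrams. For all nonzero real $\Gamma_1,\dots,\Gamma_5$, the two-colored diagram of every singular sequence is equivalent to one of the 31 diagrams of the first list, namely to one that is listed under its own value of $C$ (in particular $C\in\{0,2,4,5,6,7,8\}$), and it is equivalent to none of the 8 diagrams of the second list. -/

import Mathlib

open Filter Topology Asymptotics

namespace Vortex

/-- A point `(𝒵, 𝒲)` of the space of the extended system for `N` vortices: the positions `z`, their
"conjugates" `w`, and the quantities `Z j k` (standing for `1 / w_{jk}`) and `W j k`
(standing for `1 / z_{jk}`), where `z_{jk} = z_k - z_j` and `w_{jk} = w_k - w_j`. -/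
structure ExtendedConfiguration (N : ℕ) where
  z : Fin N → ℂ
  w : Fin N → ℂ
  Z : Fin N → Fin N → ℂ
  W : Fin N → Fin N → ℂ

namespace ExtendedConfiguration

variable {N : ℕ}

/-- The vector `𝒵 = (z_1, …, z_N, Z_{12}, …, Z_{(N-1)N})`. Antisymmetry of `Z` makes the diagonal
entries zero and the entries with `j > k` redundant, so that the (sup) norm of this element of a
product space is the maximal modulus of a component. -/
def zVec (Q : ExtendedConfiguration N) : (Fin N → ℂ) × (Fin N → Fin N → ℂ) := (Q.z, Q.Z)

/-- The vector `𝒲 = (w_1, …, w_N, W_{12}, …, W_{(N-1)N})`. -/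
def wVec (Q : ExtendedConfiguration N) : (Fin N → ℂ) × (Fin N → Fin N → ℂ) := (Q.w, Q.W)

end ExtendedConfiguration

/-- `Q` is a complex normalized central configuration of the planar `N`-vortex problem with
vorticities `Γ` and multiplier `Λ`, `|Λ| = 1`; the rotation-type freedom
`(𝒵, 𝒲) ↦ (a 𝒵, a⁻¹ 𝒲)` is normalized by `‖𝒵‖ = ‖𝒲‖`. -/
structure IsComplexNormalizedCC {N : ℕ} (Γ : Fin N → ℝ) (Λ : ℂ)
    (Q : ExtendedConfiguration N) : Prop where
  norm_multiplier : ‖Λ‖ = 1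
  eq_z : ∀ n, Λ * Q.z n = ∑ j ∈ Finset.univ.erase n, (Γ j : ℂ) * Q.Z j n
  eq_w : ∀ n, (starRingEnd ℂ) Λ * Q.w n = ∑ j ∈ Finset.univ.erase n, (Γ j : ℂ) * Q.W j n
  Z_mul : ∀ j k, j ≠ k → Q.Z j k * (Q.w k - Q.w j) = 1
  W_mul : ∀ j k, j ≠ k → Q.W j k * (Q.z k - Q.z j) = 1
  Z_antisymm : ∀ j k, Q.Z j k = -Q.Z k j
  W_antisymm : ∀ j k, Q.W j k = -Q.W k j
  norm_eq : ‖Q.zVec‖ = ‖Q.wVec‖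

/-- One and the same component of `v n` has the maximal modulus for all `n`. -/
def HasFixedMaximalComponent {N : ℕ} (v : ℕ → (Fin N → ℂ) × (Fin N → Fin N → ℂ)) : Prop :=
  (∃ k, ∀ n, ‖(v n).1 k‖ = ‖v n‖) ∨ (∃ j k, j < k ∧ ∀ n, ‖(v n).2 j k‖ = ‖v n‖)

/-- A singular sequence of complex normalized central configurations. -/
structure IsSingularSequence {N : ℕ} (Γ : Fin N → ℝ) (Λ : ℕ → ℂ)
    (Q : ℕ → ExtendedConfiguration N) : Prop where
  isCC : ∀ n, IsComplexNormalizedCC Γ (Λ n) (Q n)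
  tendsto_norm : Tendsto (fun n => ‖(Q n).zVec‖) atTop atTop
  z_fixed_max : HasFixedMaximalComponent fun n => (Q n).zVec
  w_fixed_max : HasFixedMaximalComponent fun n => (Q n).wVec
  z_converges : ∃ a, Tendsto (fun n => ‖(Q n).zVec‖⁻¹ • (Q n).zVec) atTop (𝓝 a)
  w_converges : ∃ b, Tendsto (fun n => ‖(Q n).wVec‖⁻¹ • (Q n).wVec) atTop (𝓝 b)

/-- A two-colored diagram on the vertices `Fin N`: strokes and circles of the `z`-color and of the
`w`-color. A `zw`-edge is a pair of vertices joined by strokes of both colors. -/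
@[ext]
structure TwoColoredDiagram (N : ℕ) where
  zStrokes : SimpleGraph (Fin N)
  wStrokes : SimpleGraph (Fin N)
  zCircles : Set (Fin N)
  wCircles : Set (Fin N)

namespace TwoColoredDiagram

variable {N : ℕ}

/-- The diagram with the two colors exchanged. -/
def swap (D : TwoColoredDiagram N) : TwoColoredDiagram N where
  zStrokes := D.wStrokes
  wStrokes := D.zStrokes
  zCircles := D.wCircles
  wCircles := D.zCircles

/-- `D` becomes `E` after a renumbering of the vertices. -/
def Iso (D E : TwoColoredDiagram N) : Prop :=
  ∃ σ : Equiv.Perm (Fin N),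
    (∀ j k, D.zStrokes.Adj j k ↔ E.zStrokes.Adj (σ j) (σ k)) ∧
    (∀ j k, D.wStrokes.Adj j k ↔ E.wStrokes.Adj (σ j) (σ k)) ∧
    (∀ k, k ∈ D.zCircles ↔ σ k ∈ E.zCircles) ∧
    (∀ k, k ∈ D.wCircles ↔ σ k ∈ E.wCircles)

/-- `D` and `E` are the same diagram up to a renumbering of the vertices and, possibly, an exchange
of the two colors. -/
def Equivalent (D E : TwoColoredDiagram N) : Prop := D.Iso E ∨ D.swap.Iso E

/-- A vertex is bicolored if strokes of both colors emanate from it. -/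
def IsBicolored (D : TwoColoredDiagram N) (k : Fin N) : Prop :=
  (∃ j, D.zStrokes.Adj k j) ∧ (∃ j, D.wStrokes.Adj k j)

/-- The number of strokes of either color emanating from a vertex (a `zw`-edge counts twice). -/
noncomputable def strokeCount (D : TwoColoredDiagram N) (k : Fin N) : ℕ :=
  (D.zStrokes.neighborSet k).ncard + (D.wStrokes.neighborSet k).ncard

open Classical in
/-- The maximal number `C` of strokes at a bicolored vertex; `C = 0` if there is no such vertex. -/
noncomputable def maxStrokes (D : TwoColoredDiagram N) : ℕ :=
  Finset.univ.sup fun k => if D.IsBicolored k then D.strokeCount k else 0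

/-- The diagram in which two distinct vertices are joined by a `z`-stroke (`w`-stroke) exactly if
they lie together in a member of `zs` (of `ws`), with `z`-circles at `cz` and `w`-circles at `cw`. -/
def ofCliques (zs ws : List (Finset (Fin N))) (cz cw : Finset (Fin N)) : TwoColoredDiagram N where
  zStrokes := SimpleGraph.fromRel fun j k => ∃ B ∈ zs, j ∈ B ∧ k ∈ B
  wStrokes := SimpleGraph.fromRel fun j k => ∃ B ∈ ws, j ∈ B ∧ k ∈ B
  zCircles := cz
  wCircles := cw

/-- The two-colored diagram of a sequence `Q`. With `ε⁻² = ‖𝒵‖ = ‖𝒲‖`: there is a `z`-circle at `k`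
if `z_k ≈ ε⁻²`, a `z`-stroke between `j` and `k` if `Z_{jk} ≈ ε⁻²`, and similarly for `w`. -/
def ofSequence (Q : ℕ → ExtendedConfiguration N) : TwoColoredDiagram N where
  zStrokes := SimpleGraph.fromRel fun j k =>
    (fun n => (Q n).Z j k) =Θ[atTop] fun n => ‖(Q n).zVec‖
  wStrokes := SimpleGraph.fromRel fun j k =>
    (fun n => (Q n).W j k) =Θ[atTop] fun n => ‖(Q n).wVec‖
  zCircles := {k | (fun n => (Q n).z k) =Θ[atTop] fun n => ‖(Q n).zVec‖}
  wCircles := {k | (fun n => (Q n).w k) =Θ[atTop] fun n => ‖(Q n).wVec‖}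

end TwoColoredDiagram

open TwoColoredDiagram

/-- The possible diagrams for five vortices (vertices `0, …, 4`), sorted by the maximal number `C`
of strokes at a bicolored vertex. -/
def possibleDiagrams : ℕ → List (TwoColoredDiagram 5)
  | 0 =>
    [ ofCliques [{3, 4}] [{1, 2}] {3, 4} {1, 2},
      ofCliques [{3, 4}] [{0, 1, 2}] {3, 4} ∅,
      ofCliques [{3, 4}] [{0, 1, 2}] {3, 4} {0, 1},
      ofCliques [{3, 4}] [{0, 1, 2}] {3, 4} {0, 1, 2} ]
  | 2 =>
    [ ofCliques [{1, 2}, {3, 4}] [{1, 3}, {2, 4}] {1, 2, 3, 4} {1, 2, 3, 4} ]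
  | 4 =>
    [ ofCliques [{2, 3, 4}] [{2, 3, 4}] ∅ ∅,
      ofCliques [{2, 3, 4}] [{0, 1}, {2, 3, 4}] ∅ {0, 1},
      ofCliques [{0, 1}, {2, 3, 4}] [{0, 1}, {2, 3, 4}] {0, 1, 2, 3, 4} {0, 1, 2, 3, 4},
      ofCliques [{2, 3, 4}] [{1, 2, 3}] ∅ ∅,
      ofCliques [{2, 3, 4}] [{0, 2}, {1, 3, 4}] ∅ {0, 1, 2, 3, 4},
      ofCliques [{0, 1}, {2, 3, 4}] [{0, 2}, {1, 3, 4}] {0, 1, 2, 3, 4} {0, 1, 2, 3, 4},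
      ofCliques [{2, 3, 4}] [{0, 1, 2}] ∅ ∅,
      ofCliques [{2, 3, 4}] [{0, 1, 2}] ∅ {0, 1},
      ofCliques [{2, 3, 4}] [{0, 1, 2}] {3, 4} {0, 1},
      ofCliques [{0, 1}, {2, 3, 4}] [{0, 1, 2}, {3, 4}] {0, 1, 2, 3, 4} {0, 1, 2, 3, 4} ]
  | 5 =>
    [ ofCliques [{2, 3, 4}] [{1, 2, 3, 4}] ∅ {1, 2, 3, 4},
      ofCliques [{1, 2, 3, 4}] [{0, 1}, {2, 3, 4}] {2, 3, 4} {0, 1, 2, 3, 4},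
      ofCliques [{2, 3, 4}] [{0, 1, 2, 3}] ∅ ∅,
      ofCliques [{2, 3, 4}] [{0, 1, 2, 3}] ∅ {0, 1},
      ofCliques [{1, 2, 3, 4}] [{0, 1, 2}, {3, 4}] ∅ {0, 1, 2, 3, 4} ]
  | 6 =>
    [ ofCliques [{1, 2, 3, 4}] [{1, 2, 3, 4}] ∅ ∅,
      ofCliques [{2, 3, 4}] [{0, 1, 2, 3, 4}] ∅ {0, 2, 3, 4},
      ofCliques [{2, 3, 4}] [{0, 1, 2, 3, 4}] ∅ {0, 1, 2, 3, 4},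
      ofCliques [{2, 3, 4}] [{0, 1, 2, 3, 4}] ∅ ∅,
      ofCliques [{2, 3, 4}] [{0, 1, 2, 3, 4}] ∅ {0, 1},
      ofCliques [{0, 1}, {2, 3, 4}] [{0, 1, 2, 3, 4}] {0, 1, 2, 3, 4} {2, 3, 4},
      ofCliques [{0, 1}, {2, 3, 4}] [{0, 1, 2, 3, 4}] {0, 1, 2, 3, 4} {0, 1, 2, 3, 4},
      ofCliques [{1, 2, 3, 4}] [{0, 1, 2, 3}] ∅ ∅ ]
  | 7 =>
    [ ofCliques [{1, 2, 3, 4}] [{0, 1, 2, 3, 4}] ∅ {0, 1, 2, 3, 4} ]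
  | 8 =>
    [ ofCliques [{0, 1, 2, 3, 4}] [{0, 1, 2, 3, 4}] ∅ ∅,
      ofCliques [{0, 1, 2, 3, 4}] [{0, 1, 2, 3, 4}] {0, 1, 2, 3, 4} {0, 1, 2, 3, 4} ]
  | _ => []

/-- All possible diagrams, for `C = 0, …, 8`, in one list. -/
def allPossibleDiagrams : List (TwoColoredDiagram 5) := (List.range 9).flatMap possibleDiagrams

/-- The eight candidate diagrams that do not occur. -/
def excludedDiagrams : List (TwoColoredDiagram 5) :=
  [ ofCliques [{1, 2}, {3, 4}] [{1, 2}, {3, 4}] {1, 2, 3, 4} {1, 2, 3, 4},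
    ofCliques [{2, 3, 4}] [{1, 2}, {3, 4}] ∅ {1, 2, 3, 4},
    ofCliques [{2, 3, 4}] [{1, 2}, {3, 4}] {3, 4} {1, 2, 3, 4},
    ofCliques [{2, 3, 4}] [{2, 3, 4}] {2, 3, 4} {2, 3, 4},
    ofCliques [{2, 3, 4}] [{0, 1}, {2, 3, 4}] {2, 3, 4} {0, 1, 2, 3, 4},
    ofCliques [{1, 2}, {3, 4}] [{1, 2, 3, 4}] {1, 2, 3, 4} {1, 2, 3, 4},
    ofCliques [{1, 2, 3, 4}] [{0, 1, 2}, {3, 4}] ∅ {1, 2, 3, 4},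
    ofCliques [{1, 2, 3, 4}] [{1, 2, 3, 4}] {1, 2, 3, 4} {1, 2, 3, 4} ]

end Vortex

/-!
Rescale a singular sequence by `R = ‖𝒵‖ = ‖𝒲‖ → ∞` and let `a, b, A, B` be the limits of
`z / R, w / R, Z / R, W / R`. These exist by assumption; only for the multipliers `Λ_n` a limit has
to be chosen, along an ultrafilter. The diagram consists of the nonzero limits: `A j k ≠ 0` is a
`z`-stroke, `a k ≠ 0` a `z`-circle, and similarly for `w` (`IsSingularSequence.exists_limits`).

Everything that is needed about one color passes to the limit (`IsHalfLimit`), and the other color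
follows by exchanging the roles:
* On a `z`-stroke `R (w_k - w_j)` tends to `(A j k)⁻¹`. Hence `b j = b k`, and the `z`-strokes form
  complete graphs on disjoint classes. The vector `a` solves `Λ a_k = ∑_j Γ_j A_{jk}`, which couples
  only vertices of the same class, so that each class `K` satisfies `∑_K Γ_k a_k = 0` and the virial
  identity `Λ ∑_K Γ_k a_k / A_{xk} = ∑_{j < k} Γ_j Γ_k` for `x ∈ K`.
* Suppose that the `w`-circled vertices are divided into `z`-classes of total vorticity zero that
  are also joined by `w`-strokes. Multiplying the equation for `z_n` by `Γ_n w_c`, where `c` is a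
  representative of the class of `n`, and summing over the `w`-circled vertices, the interactions
  cancel in the limit, and `∑ Γ_n b_n / B_{cn} = 0` remains (`RescaledLimit.balance`).

Since the vorticities are real and nonzero, `∑_{j < k} Γ_j Γ_k = -½ ∑ Γ_k² ≠ 0` on a set of total
vorticity zero. This turns the relations into combinatorial obstructions:
`IsHalfLimit.not_decomposed`, `IsHalfLimit.not_nested` and `IsHalfLimit.not_balanced`. Together with
the elementary facts that no circle is alone in its class, that a vertex of only one stroke is
circled, and that circles of one color are constant on the classes of the other one, they leave only
diagrams of the first list. This last step is a finite computation over pairs of equivalence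
relations on five vertices, one of them in canonical position, and pairs of sets of circles
(`DiagramCode.isPossible_of_rules`). That the 39 diagrams are inequivalent is seen from a numerical
invariant (`nodup_hash_mul`).
-/

namespace Vortex

open TwoColoredDiagram

/-! ### Limits of rescaled solutions -/

/-- If the weights `g` sum to zero over each fiber of `c` on `S`, then `g` annihilates every
function that is constant on these fibers. -/
theorem sum_mul_comp_eq_zero {ι : Type*} [DecidableEq ι] (S : Finset ι) (c : ι → ι) (g : ι → ℂ)
    (h : ∀ i ∈ S, ∑ m ∈ S with c m = c i, g m = 0) (f : ι → ℂ) :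
    ∑ i ∈ S, g i * f (c i) = 0 := by
  rw [← Finset.sum_fiberwise_of_maps_to (t := S.image c) (g := c)
    (fun i hi => Finset.mem_image_of_mem c hi)]
  refine Finset.sum_eq_zero fun k hk => ?_
  obtain ⟨i, hi, rfl⟩ := Finset.mem_image.1 hk
  rw [Finset.sum_congr rfl (g := fun m => g m * f (c i))
    (fun m hm => by rw [(Finset.mem_filter.1 hm).2]), ← Finset.sum_mul, h i hi, zero_mul]

/-- A sequence of solutions of the equations that govern one color (`𝒵` plays the leading role),
together with a scale `r → ∞` and the limits `a, b, A, B` of `z, w, Z, W` at this scale. -/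
structure RescaledLimit {N : ℕ} (F : Filter ℕ) (Γ : Fin N → ℝ) (Λ r : ℕ → ℂ)
    (z w : ℕ → Fin N → ℂ) (Z W : ℕ → Fin N → Fin N → ℂ) (Λ' : ℂ)
    (a b : Fin N → ℂ) (A B : Fin N → Fin N → ℂ) : Prop where
  eq_z : ∀ n k, Λ n * z n k = ∑ j, (Γ j : ℂ) * Z n j k
  Z_mul : ∀ n j k, j ≠ k → Z n j k * (w n k - w n j) = 1
  W_mul : ∀ n j k, j ≠ k → W n j k * (z n k - z n j) = 1
  Z_antisymm : ∀ n j k, Z n j k = -Z n k j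
  W_antisymm : ∀ n j k, W n j k = -W n k j
  scale_ne : ∀ᶠ n in F, r n ≠ 0
  scale_inv : Tendsto (fun n => (r n)⁻¹) F (𝓝 0)
  tendsto_Λ : Tendsto Λ F (𝓝 Λ')
  Λ_ne : Λ' ≠ 0
  tendsto_z : ∀ k, Tendsto (fun n => (r n)⁻¹ * z n k) F (𝓝 (a k))
  tendsto_w : ∀ k, Tendsto (fun n => (r n)⁻¹ * w n k) F (𝓝 (b k))
  tendsto_Z : ∀ j k, Tendsto (fun n => (r n)⁻¹ * Z n j k) F (𝓝 (A j k))
  tendsto_W : ∀ j k, Tendsto (fun n => (r n)⁻¹ * W n j k) F (𝓝 (B j k))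

/-- The relations between the limits that come from one color. `A j k ≠ 0` means that a `z`-stroke
joins `j` and `k`, and `a k ≠ 0` that `k` is `z`-circled. On a `z`-stroke, `(A j k)⁻¹` is the limit
of `ε⁻² (w_k - w_j)`; it is zero for `j = k`, in agreement with the convention for inverses. -/
structure IsHalfLimit {N : ℕ} (Γ : Fin N → ℝ) (Λ : ℂ) (a b : Fin N → ℂ)
    (A B : Fin N → Fin N → ℂ) : Prop where
  Λ_ne : Λ ≠ 0
  antisymm : ∀ j k, A j k = -A k j
  eq_a : ∀ k, Λ * a k = ∑ j, (Γ j : ℂ) * A j k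
  b_eq : ∀ j k, A j k ≠ 0 → b j = b k
  cocycle : ∀ j k l, A j k ≠ 0 → A k l ≠ 0 → j ≠ l →
    A j l ≠ 0 ∧ (A j l)⁻¹ = (A j k)⁻¹ + (A k l)⁻¹
  /-- Here `S` is the set of `w`-circled vertices, and `c` picks a representative of each `z`-class
  in `S`. -/
  balance : ∀ (S : Finset (Fin N)) (c : Fin N → Fin N),
    (∀ i, i ∈ S ↔ b i ≠ 0) →
    (∀ i ∈ S, c i = i ∨ (A (c i) i ≠ 0 ∧ B (c i) i ≠ 0)) →
    (∀ i j, A i j ≠ 0 → c i = c j) →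
    (∀ i ∈ S, ∑ m ∈ S with c m = c i, (Γ m : ℂ) = 0) →
    ∑ i ∈ S, (Γ i : ℂ) * (b i * (B (c i) i)⁻¹) = 0

namespace RescaledLimit

variable {N : ℕ} {F : Filter ℕ} {Γ : Fin N → ℝ} {Λ r : ℕ → ℂ}
    {z w : ℕ → Fin N → ℂ} {Z W : ℕ → Fin N → Fin N → ℂ} {Λ' : ℂ}
    {a b : Fin N → ℂ} {A B : Fin N → Fin N → ℂ}

theorem relabel (h : RescaledLimit F Γ Λ r z w Z W Λ' a b A B) (σ : Equiv.Perm (Fin N)) :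
    RescaledLimit F (Γ ∘ σ) Λ r (fun n => z n ∘ σ) (fun n => w n ∘ σ)
      (fun n j k => Z n (σ j) (σ k)) (fun n j k => W n (σ j) (σ k)) Λ' (a ∘ σ) (b ∘ σ)
      (fun j k => A (σ j) (σ k)) (fun j k => B (σ j) (σ k)) where
  eq_z n k := by
    simpa using (h.eq_z n (σ k)).trans
      (Equiv.sum_comp σ fun j => (Γ j : ℂ) * Z n j (σ k)).symm
  Z_mul n j k hjk := h.Z_mul n _ _ (σ.injective.ne hjk)
  W_mul n j k hjk := h.W_mul n _ _ (σ.injective.ne hjk)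
  Z_antisymm n j k := h.Z_antisymm n _ _
  W_antisymm n j k := h.W_antisymm n _ _
  scale_ne := h.scale_ne
  scale_inv := h.scale_inv
  tendsto_Λ := h.tendsto_Λ
  Λ_ne := h.Λ_ne
  tendsto_z k := h.tendsto_z _
  tendsto_w k := h.tendsto_w _
  tendsto_Z j k := h.tendsto_Z _ _
  tendsto_W j k := h.tendsto_W _ _

theorem antisymm [F.NeBot] (h : RescaledLimit F Γ Λ r z w Z W Λ' a b A B) (j k : Fin N) :
    A j k = -A k j := by
  refine tendsto_nhds_unique (h.tendsto_Z j k) ?_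
  refine (h.tendsto_Z k j).neg.congr fun n => ?_
  rw [h.Z_antisymm n j k, mul_neg]

theorem diag [F.NeBot] (h : RescaledLimit F Γ Λ r z w Z W Λ' a b A B) (k : Fin N) : A k k = 0 :=
  self_eq_neg.1 (h.antisymm k k)

theorem antisymm_B [F.NeBot] (h : RescaledLimit F Γ Λ r z w Z W Λ' a b A B) (j k : Fin N) :
    B j k = -B k j := by
  refine tendsto_nhds_unique (h.tendsto_W j k) ?_
  refine (h.tendsto_W k j).neg.congr fun n => ?_
  rw [h.W_antisymm n j k, mul_neg]

/-- On a `z`-stroke the `w`-distance is of the order of the inverse scale. -/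
theorem tendsto_w_sub [F.NeBot] (h : RescaledLimit F Γ Λ r z w Z W Λ' a b A B) {j k : Fin N}
    (hA : A j k ≠ 0) : Tendsto (fun n => r n * (w n k - w n j)) F (𝓝 (A j k)⁻¹) := by
  have hjk : j ≠ k := by rintro rfl; exact hA (h.diag j)
  refine ((h.tendsto_Z j k).inv₀ hA).congr fun n => ?_
  rw [mul_inv, inv_inv, eq_inv_of_mul_eq_one_right (h.Z_mul n j k hjk)]

theorem tendsto_z_sub [F.NeBot] (h : RescaledLimit F Γ Λ r z w Z W Λ' a b A B) {j k : Fin N}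
    (hB : B j k ≠ 0) : Tendsto (fun n => r n * (z n k - z n j)) F (𝓝 (B j k)⁻¹) := by
  have hjk : j ≠ k := by rintro rfl; exact hB (self_eq_neg.1 (h.antisymm_B j j))
  refine ((h.tendsto_W j k).inv₀ hB).congr fun n => ?_
  rw [mul_inv, inv_inv, eq_inv_of_mul_eq_one_right (h.W_mul n j k hjk)]

theorem eq_a [F.NeBot] (h : RescaledLimit F Γ Λ r z w Z W Λ' a b A B) (k : Fin N) :
    Λ' * a k = ∑ j, (Γ j : ℂ) * A j k := by
  refine tendsto_nhds_unique (h.tendsto_Λ.mul (h.tendsto_z k)) ?_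
  refine (tendsto_finsetSum _ fun j _ => (h.tendsto_Z j k).const_mul (Γ j : ℂ)).congr fun n => ?_
  rw [mul_left_comm, h.eq_z, Finset.mul_sum]
  exact Finset.sum_congr rfl fun j _ => by ring

theorem b_eq [F.NeBot] (h : RescaledLimit F Γ Λ r z w Z W Λ' a b A B)
    {j k : Fin N} (hA : A j k ≠ 0) :
    b j = b k := by
  have h1 : Tendsto (fun n => (r n)⁻¹ * w n k - (r n)⁻¹ * w n j) F (𝓝 (b k - b j)) :=
    (h.tendsto_w k).sub (h.tendsto_w j)
  have h2 : Tendsto (fun n => (r n)⁻¹ * w n k - (r n)⁻¹ * w n j) F (𝓝 (0 * 0 * (A j k)⁻¹)) := by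
    refine ((h.scale_inv.mul h.scale_inv).mul (h.tendsto_w_sub hA)).congr' ?_
    filter_upwards [h.scale_ne] with n hn
    field_simp
  have := tendsto_nhds_unique h1 h2
  rw [zero_mul, zero_mul, sub_eq_zero] at this
  exact this.symm

theorem cocycle [F.NeBot] (h : RescaledLimit F Γ Λ r z w Z W Λ' a b A B) {j k l : Fin N}
    (h1 : A j k ≠ 0) (h2 : A k l ≠ 0) (hjl : j ≠ l) :
    A j l ≠ 0 ∧ (A j l)⁻¹ = (A j k)⁻¹ + (A k l)⁻¹ := by
  have h3 : A j l * ((A j k)⁻¹ + (A k l)⁻¹) = 1 := by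
    refine tendsto_nhds_unique
      ((h.tendsto_Z j l).mul ((h.tendsto_w_sub h1).add (h.tendsto_w_sub h2))) ?_
    refine tendsto_const_nhds.congr' ?_
    filter_upwards [h.scale_ne] with n hn
    rw [← h.Z_mul n j l hjl]
    field_simp
    ring
  exact ⟨left_ne_zero_of_mul_eq_one h3, (eq_inv_of_mul_eq_one_right h3).symm⟩

/-- If `k` is joined to `k'` by a `z`-stroke but `j` and `i` are not, then replacing `w_k` by `w_k'`
changes nothing in products with `Z_{ji}` in the limit. -/
theorem tendsto_w_sub_mul_Z [F.NeBot] (h : RescaledLimit F Γ Λ r z w Z W Λ' a b A B)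
    {k k' i j : Fin N} (hk : k = k' ∨ A k k' ≠ 0) (hij : A j i = 0) :
    Tendsto (fun n => (w n k - w n k') * Z n j i) F (𝓝 0) := by
  rcases hk with rfl | hk
  · simp
  · have := (h.tendsto_w_sub hk).neg.mul (h.tendsto_Z j i)
    rw [hij, mul_zero] at this
    refine this.congr' ?_
    filter_upwards [h.scale_ne] with n hn
    field_simp
    ring

/-- If `i` is `w`-circled and `j` is not, then `w_i / w_{ji} → 1`. -/
theorem tendsto_w_mul_Z (h : RescaledLimit F Γ Λ r z w Z W Λ' a b A B) {i j : Fin N}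
    (hi : b i ≠ 0) (hj : b j = 0) : Tendsto (fun n => w n i * Z n j i) F (𝓝 1) := by
  have hji : j ≠ i := by rintro rfl; exact hi hj
  have hd : Tendsto (fun n => (r n)⁻¹ * w n i - (r n)⁻¹ * w n j) F (𝓝 (b i)) := by
    simpa [hj] using (h.tendsto_w i).sub (h.tendsto_w j)
  have := (h.tendsto_w i).div hd hi
  rw [div_self hi] at this
  refine this.congr' ?_
  filter_upwards [h.scale_ne] with n hn
  have hZ := h.Z_mul n j i hji
  have hne : w n i - w n j ≠ 0 := right_ne_zero_of_mul_eq_one hZ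
  rw [eq_inv_of_mul_eq_one_left hZ]
  simp only [Pi.div_apply]
  rw [← mul_sub, mul_div_mul_left _ _ (inv_ne_zero hn), div_eq_mul_inv]

/-- The balance of a system of `w`-circled clusters of zero total vorticity: after replacing `w_i`
by the position of the representative of its cluster, the interaction of any two vertices of
different clusters contributes `Γ_i Γ_j` in the limit, and these contributions cancel. -/
theorem balance [F.NeBot] (h : RescaledLimit F Γ Λ r z w Z W Λ' a b A B)
    (S : Finset (Fin N)) (c : Fin N → Fin N)
    (hS : ∀ i, i ∈ S ↔ b i ≠ 0)
    (hc : ∀ i ∈ S, c i = i ∨ (A (c i) i ≠ 0 ∧ B (c i) i ≠ 0))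
    (hcA : ∀ i j, A i j ≠ 0 → c i = c j)
    (hΓ : ∀ i ∈ S, ∑ m ∈ S with c m = c i, (Γ m : ℂ) = 0) :
    ∑ i ∈ S, (Γ i : ℂ) * (b i * (B (c i) i)⁻¹) = 0 := by
  classical
  set s : Fin N → ℂ := fun i => if i ∈ S then 1 else 0 with hs
  set v : ℕ → Fin N → ℂ := fun n i => if i ∈ S then w n (c i) else 0 with hv
  set e : Fin N → Fin N → ℂ := fun i j => s i + s j - s i * s j -
    s i * (if c j = c i then s j else 0) with he
  have hcz : ∀ i ∈ S, c i = i ∨ A (c i) i ≠ 0 := fun i hi => (hc i hi).imp id And.left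
  -- the pairwise limits
  have hpair : ∀ i j, Tendsto (fun n => (v n i - v n j) * Z n j i) F (𝓝 (e i j)) := by
    have hmixed : ∀ i ∈ S, ∀ j ∉ S, Tendsto (fun n => w n (c i) * Z n j i) F (𝓝 1) := by
      intro i hi j hj
      have hbi := (hS i).1 hi
      have hbj : b j = 0 := by simpa using mt (hS j).2 hj
      have hA : A j i = 0 := by
        by_contra hne
        exact hbi ((h.b_eq hne).symm.trans hbj)
      have := (h.tendsto_w_sub_mul_Z (hcz i hi) hA).add (h.tendsto_w_mul_Z hbi hbj)
      rw [zero_add] at this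
      exact this.congr fun n => by ring
    intro i j
    by_cases hi : i ∈ S <;> by_cases hj : j ∈ S
    · by_cases hij : c j = c i
      · simp [hv, he, hs, hi, hj, hij]
      · have hne : j ≠ i := by rintro rfl; exact hij rfl
        have hA : A j i = 0 := by
          by_contra hA
          exact hij (hcA j i hA)
        have := ((h.tendsto_w_sub_mul_Z (hcz i hi) hA).sub
          (h.tendsto_w_sub_mul_Z (hcz j hj) hA)).add (tendsto_const_nhds (x := (1 : ℂ)))
        have h1 : e i j = 0 - 0 + 1 := by simp [he, hs, hi, hj, hij]
        rw [h1]
        refine this.congr fun n => ?_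
        simp only [hv, hi, hj, if_true]
        linear_combination -(h.Z_mul n j i hne)
    · simpa [hv, he, hs, hi, hj] using hmixed i hi j hj
    · have h1 : e i j = 1 := by simp [he, hs, hi, hj]
      rw [h1]
      refine (hmixed j hj i hi).congr fun n => ?_
      simp only [hv, hi, hj, if_true, if_false]
      rw [h.Z_antisymm n j i]
      ring
    · simp [hv, he, hs, hi, hj]
  have hsum0 : ∑ i ∈ S, (Γ i : ℂ) = 0 := by
    simpa using sum_mul_comp_eq_zero S c (fun i => (Γ i : ℂ)) hΓ fun _ => 1
  have hsΓ : ∑ i, (Γ i : ℂ) * s i = 0 := by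
    simpa [hs, Finset.sum_ite_mem] using hsum0
  -- the limits of the pairwise interactions cancel
  have he0 : ∑ i, ∑ j, (Γ i : ℂ) * Γ j * e i j = 0 := by
    have h1 : ∀ i, ∑ j, (Γ i : ℂ) * Γ j * e i j = Γ i * s i * ∑ j, (Γ j : ℂ) := by
      intro i
      have h2 : Γ i * s i * ∑ j, (Γ j : ℂ) * (if c j = c i then s j else 0) = 0 := by
        by_cases hi : i ∈ S
        · have h3 : ∑ j, (Γ j : ℂ) * (if c j = c i then s j else 0) = 0 := by
            refine Eq.trans ?_ (hΓ i hi)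
            rw [Finset.sum_filter, ← Finset.univ_inter S, ← Finset.sum_ite_mem]
            refine Finset.sum_congr rfl fun j _ => ?_
            simp only [hs]
            split_ifs <;> simp
          rw [h3, mul_zero]
        · simp [hs, hi]
      have h4 : ∑ j, (Γ i : ℂ) * Γ j * e i j = Γ i * s i * ∑ j, (Γ j : ℂ) +
          (Γ i - Γ i * s i) * ∑ j, (Γ j : ℂ) * s j -
          Γ i * s i * ∑ j, (Γ j : ℂ) * (if c j = c i then s j else 0) := by
        rw [Finset.mul_sum, Finset.mul_sum, Finset.mul_sum, ← Finset.sum_add_distrib,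
          ← Finset.sum_sub_distrib]
        refine Finset.sum_congr rfl fun j _ => ?_
        simp only [he]
        ring
      rw [h4, h2, hsΓ]
      ring
    simp_rw [h1]
    rw [← Finset.sum_mul, hsΓ, zero_mul]
  have hlim1 : Tendsto (fun n => 2 * (Λ n * ∑ i, (Γ i : ℂ) * (v n i * z n i))) F (𝓝 0) := by
    rw [← he0]
    refine (tendsto_finsetSum _ fun i _ => tendsto_finsetSum _ fun j _ =>
      (hpair i j).const_mul ((Γ i : ℂ) * Γ j)).congr fun n => ?_
    have h1 : Λ n * ∑ i, (Γ i : ℂ) * (v n i * z n i) =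
        ∑ i, ∑ j, (Γ i : ℂ) * Γ j * (v n i * Z n j i) := by
      rw [Finset.mul_sum]
      refine Finset.sum_congr rfl fun i _ => ?_
      rw [show Λ n * ((Γ i : ℂ) * (v n i * z n i)) = Γ i * v n i * (Λ n * z n i) by ring,
        h.eq_z, Finset.mul_sum]
      exact Finset.sum_congr rfl fun j _ => by ring
    have h2 : ∑ i, ∑ j, (Γ i : ℂ) * Γ j * (v n i * Z n j i) =
        ∑ i, ∑ j, (Γ i : ℂ) * Γ j * (-(v n j) * Z n j i) := by
      rw [Finset.sum_comm]
      refine Finset.sum_congr rfl fun i _ => Finset.sum_congr rfl fun j _ => ?_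
      rw [h.Z_antisymm n i j]
      ring
    rw [two_mul, h1]
    nth_rewrite 2 [h2]
    rw [← Finset.sum_add_distrib]
    refine Finset.sum_congr rfl fun i _ => ?_
    rw [← Finset.sum_add_distrib]
    exact Finset.sum_congr rfl fun j _ => by ring
  have hlim2 : Tendsto (fun n => ∑ i, (Γ i : ℂ) * (v n i * z n i)) F
      (𝓝 (∑ i ∈ S, (Γ i : ℂ) * (b i * (B (c i) i)⁻¹))) := by
    have h1 : ∀ i ∈ S, Tendsto (fun n => (Γ i : ℂ) * (w n (c i) * (z n i - z n (c i)))) F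
        (𝓝 ((Γ i : ℂ) * (b i * (B (c i) i)⁻¹))) := by
      intro i hi
      refine Tendsto.const_mul _ ?_
      rcases hc i hi with hci | ⟨hA, hB⟩
      · rw [hci, self_eq_neg.1 (h.antisymm_B i i)]
        simp
      · have := (h.tendsto_w (c i)).mul (h.tendsto_z_sub hB)
        rw [h.b_eq hA] at this
        refine this.congr' ?_
        filter_upwards [h.scale_ne] with n hn
        field_simp
    refine (tendsto_finsetSum S h1).congr fun n => ?_
    have h2 : ∑ i ∈ S, (Γ i : ℂ) * (w n (c i) * z n (c i)) = 0 :=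
      sum_mul_comp_eq_zero S c (fun i => (Γ i : ℂ)) hΓ fun k => w n k * z n k
    have h3 : ∑ i, (Γ i : ℂ) * (v n i * z n i) = ∑ i ∈ S, (Γ i : ℂ) * (w n (c i) * z n i) := by
      simp only [hv, ite_mul, zero_mul, mul_ite, mul_zero]
      rw [Finset.sum_ite_mem, Finset.univ_inter]
    rw [h3, ← sub_zero (∑ i ∈ S, (Γ i : ℂ) * (w n (c i) * z n i)), ← h2,
      ← Finset.sum_sub_distrib]
    exact Finset.sum_congr rfl fun i _ => by ring
  have := tendsto_nhds_unique hlim1 ((h.tendsto_Λ.mul hlim2).const_mul 2)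
  have h0 : Λ' * ∑ i ∈ S, (Γ i : ℂ) * (b i * (B (c i) i)⁻¹) = 0 := by
    linear_combination -(this / 2)
  exact (mul_eq_zero.1 h0).resolve_left h.Λ_ne

theorem isHalfLimit [F.NeBot] (h : RescaledLimit F Γ Λ r z w Z W Λ' a b A B) :
    IsHalfLimit Γ Λ' a b A B where
  Λ_ne := h.Λ_ne
  antisymm := h.antisymm
  eq_a := h.eq_a
  b_eq _ _ := h.b_eq
  cocycle _ _ _ := h.cocycle
  balance := h.balance

end RescaledLimit

/-! ### Relations within the components of one color -/

namespace IsHalfLimit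

variable {N : ℕ} {Γ : Fin N → ℝ} {Λ M : ℂ} {a b : Fin N → ℂ} {A B : Fin N → Fin N → ℂ}

theorem diag (h : IsHalfLimit Γ Λ a b A B) (k : Fin N) : A k k = 0 :=
  self_eq_neg.1 (h.antisymm k k)

theorem symm (h : IsHalfLimit Γ Λ a b A B) {j k : Fin N} (hA : A j k ≠ 0) : A k j ≠ 0 := by
  rwa [h.antisymm, neg_ne_zero]

/-- Two vertices are equivalent if they are equal or joined by a `z`-stroke. -/
theorem equivalence (h : IsHalfLimit Γ Λ a b A B) :
    Equivalence fun j k => j = k ∨ A j k ≠ 0 where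
  refl _ := Or.inl rfl
  symm := by
    rintro j k (rfl | hA)
    · exact Or.inl rfl
    · exact Or.inr (h.symm hA)
  trans := by
    rintro j k l (rfl | h1) h2
    · exact h2
    · rcases h2 with rfl | h2
      · exact Or.inr h1
      · by_cases hjl : j = l
        · exact Or.inl hjl
        · exact Or.inr (h.cocycle j k l h1 h2 hjl).1

/-- The class of the vertex `x`: an isolated component of the `z`-diagram. -/
noncomputable def cls (A : Fin N → Fin N → ℂ) (x : Fin N) : Finset (Fin N) :=
  open Classical in Finset.univ.filter fun y => x = y ∨ A x y ≠ 0

theorem mem_cls {x y : Fin N} : y ∈ cls A x ↔ x = y ∨ A x y ≠ 0 := by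
  simp [cls]

theorem self_mem_cls (x : Fin N) : x ∈ cls A x := mem_cls.2 (Or.inl rfl)

theorem cls_eq (h : IsHalfLimit Γ Λ a b A B) {x y : Fin N} (hy : y ∈ cls A x) :
    cls A y = cls A x := by
  ext t
  rw [mem_cls] at *
  rw [mem_cls]
  exact ⟨fun ht => h.equivalence.trans hy ht,
    fun ht => h.equivalence.trans (h.equivalence.symm hy) ht⟩

theorem b_eq_of_mem (h : IsHalfLimit Γ Λ a b A B) {x y : Fin N} (hy : y ∈ cls A x) :
    b y = b x := by
  rcases mem_cls.1 hy with rfl | hA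
  · rfl
  · exact (h.b_eq _ _ hA).symm

theorem eq_a_cls (h : IsHalfLimit Γ Λ a b A B) {x k : Fin N} (hk : k ∈ cls A x) :
    Λ * a k = ∑ j ∈ cls A x, (Γ j : ℂ) * A j k := by
  rw [h.eq_a]
  refine (Finset.sum_subset (Finset.subset_univ _) fun j _ hj => ?_).symm
  rw [← h.cls_eq hk, mem_cls, not_or, not_not] at hj
  rw [h.antisymm, hj.2, neg_zero, mul_zero]

/-- The center of vorticity of a class is at the origin in the limit. -/
theorem sum_cls_eq_zero (h : IsHalfLimit Γ Λ a b A B) (x : Fin N) :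
    ∑ k ∈ cls A x, (Γ k : ℂ) * a k = 0 := by
  have h1 : Λ * ∑ k ∈ cls A x, (Γ k : ℂ) * a k =
      ∑ k ∈ cls A x, ∑ j ∈ cls A x, (Γ k : ℂ) * Γ j * A j k := by
    rw [Finset.mul_sum]
    refine Finset.sum_congr rfl fun k hk => ?_
    rw [mul_left_comm, h.eq_a_cls hk, Finset.mul_sum]
    exact Finset.sum_congr rfl fun j _ => by ring
  have h2 : ∑ k ∈ cls A x, ∑ j ∈ cls A x, (Γ k : ℂ) * Γ j * A j k =
      -∑ k ∈ cls A x, ∑ j ∈ cls A x, (Γ k : ℂ) * Γ j * A j k := by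
    conv_lhs => rw [Finset.sum_comm]
    rw [← Finset.sum_neg_distrib]
    refine Finset.sum_congr rfl fun k _ => ?_
    rw [← Finset.sum_neg_distrib]
    refine Finset.sum_congr rfl fun j _ => ?_
    rw [h.antisymm k j]
    ring
  rw [self_eq_neg.1 h2] at h1
  exact (mul_eq_zero.1 h1).resolve_left h.Λ_ne

/-- The virial identity of a class: the right hand side is twice `∑_{j < k} Γ_j Γ_k`. -/
theorem virial (h : IsHalfLimit Γ Λ a b A B) (x : Fin N) :
    2 * (Λ * ∑ k ∈ cls A x, (Γ k : ℂ) * (a k * (A x k)⁻¹)) =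
      (((∑ k ∈ cls A x, Γ k) ^ 2 - ∑ k ∈ cls A x, Γ k ^ 2 : ℝ) : ℂ) := by
  have h1 : Λ * ∑ k ∈ cls A x, (Γ k : ℂ) * (a k * (A x k)⁻¹) =
      ∑ k ∈ cls A x, ∑ j ∈ cls A x, (Γ k : ℂ) * Γ j * (A j k * (A x k)⁻¹) := by
    rw [Finset.mul_sum]
    refine Finset.sum_congr rfl fun k hk => ?_
    rw [show Λ * ((Γ k : ℂ) * (a k * (A x k)⁻¹)) = Γ k * (A x k)⁻¹ * (Λ * a k) by ring,
      h.eq_a_cls hk, Finset.mul_sum]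
    exact Finset.sum_congr rfl fun j _ => by ring
  have h2 : ∑ k ∈ cls A x, ∑ j ∈ cls A x, (Γ k : ℂ) * Γ j * (A j k * (A x k)⁻¹) =
      ∑ k ∈ cls A x, ∑ j ∈ cls A x, (Γ k : ℂ) * Γ j * -(A j k * (A x j)⁻¹) := by
    rw [Finset.sum_comm]
    refine Finset.sum_congr rfl fun k _ => Finset.sum_congr rfl fun j _ => ?_
    rw [h.antisymm k j]
    ring
  have h3 : ∀ j ∈ cls A x, ∀ k ∈ cls A x,
      A j k * (A x k)⁻¹ - A j k * (A x j)⁻¹ = if k = j then 0 else 1 := by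
    intro j hj k hk
    split_ifs with hkj
    · rw [hkj, h.diag]; ring
    · have hjk : A j k ≠ 0 := by
        rw [← h.cls_eq hj, mem_cls] at hk
        exact hk.resolve_left (Ne.symm hkj)
      have hinv : (A j k)⁻¹ = (A x k)⁻¹ - (A x j)⁻¹ := by
        rcases mem_cls.1 hj with rfl | hxj
        · rw [h.diag, inv_zero, sub_zero]
        · by_cases hxk : x = k
          · rw [← hxk, h.diag, h.antisymm, inv_neg, inv_zero]
            ring
          · rw [(h.cocycle x j k hxj hjk hxk).2]
            ring
      rw [← mul_sub, ← hinv, mul_inv_cancel₀ hjk]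
  rw [h1, two_mul]
  nth_rewrite 2 [h2]
  rw [← Finset.sum_add_distrib]
  push_cast
  rw [pow_two, Finset.sum_mul_sum, ← Finset.sum_sub_distrib]
  refine Finset.sum_congr rfl fun k hk => ?_
  rw [← Finset.sum_add_distrib]
  have h4 : ((Γ k : ℂ)) ^ 2 = ∑ j ∈ cls A x, if k = j then (Γ k : ℂ) * Γ j else 0 := by
    rw [Finset.sum_ite_eq, if_pos hk, pow_two]
  rw [h4, ← Finset.sum_sub_distrib]
  refine Finset.sum_congr rfl fun j hj => ?_
  have h5 := h3 j hj k hk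
  split_ifs at h5 ⊢ <;> linear_combination ((Γ k : ℂ) * Γ j) * h5

/-- A class without circles satisfies `∑_{j < k} Γ_j Γ_k = 0`. -/
theorem sq_sum_of_not_circled (h : IsHalfLimit Γ Λ a b A B) {x : Fin N}
    (hx : ∀ y ∈ cls A x, a y = 0) :
    (∑ k ∈ cls A x, Γ k) ^ 2 = ∑ k ∈ cls A x, Γ k ^ 2 := by
  have := h.virial x
  rw [Finset.sum_eq_zero (fun k hk => by rw [hx k hk, zero_mul, mul_zero]), mul_zero,
    mul_zero] at this
  exact sub_eq_zero.1 (Complex.ofReal_eq_zero.1 this.symm)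

/-- If all circled vertices of a class lie in one set on which `a` is constant, their total
vorticity vanishes. -/
theorem sum_circled_eq_zero (h : IsHalfLimit Γ Λ a b A B) {x : Fin N} {α : ℂ} (hα : α ≠ 0)
    {T : Finset (Fin N)} (hT : ∀ y, y ∈ T ↔ y ∈ cls A x ∧ a y ≠ 0) (ha : ∀ y ∈ T, a y = α) :
    ∑ k ∈ T, Γ k = 0 := by
  have h1 : ∑ k ∈ T, (Γ k : ℂ) * a k = 0 := by
    rw [← h.sum_cls_eq_zero x]
    refine Finset.sum_subset (fun y hy => ((hT y).1 hy).1) fun y hy hyT => ?_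
    have : a y = 0 := by
      by_contra hne
      exact hyT ((hT y).2 ⟨hy, hne⟩)
    rw [this, mul_zero]
  rw [Finset.sum_congr rfl fun k hk => by rw [ha k hk], ← Finset.sum_mul] at h1
  have h2 := (mul_eq_zero.1 h1).resolve_right hα
  exact_mod_cast h2

/-- The circles of a class are not alone. -/
theorem exists_other_circle (h : IsHalfLimit Γ Λ a b A B) (hΓ : ∀ j, Γ j ≠ 0) {x : Fin N}
    (hx : a x ≠ 0) : ∃ y, y ≠ x ∧ (x = y ∨ A x y ≠ 0) ∧ a y ≠ 0 := by
  by_contra! hno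
  have := h.sum_cls_eq_zero x
  rw [Finset.sum_eq_single_of_mem x (self_mem_cls x)
    (fun y hy hyx => by rw [hno y hyx (mem_cls.1 hy), mul_zero])] at this
  exact (mul_ne_zero (Complex.ofReal_ne_zero.2 (hΓ x)) hx) this

/-- A vertex of exactly one stroke is circled. -/
theorem exists_other_stroke (h : IsHalfLimit Γ Λ a b A B) (hΓ : ∀ j, Γ j ≠ 0) {x y : Fin N}
    (hxy : x ≠ y) (hA : x = y ∨ A x y ≠ 0) (hx : a x = 0) :
    ∃ k, k ≠ x ∧ k ≠ y ∧ (x = k ∨ A x k ≠ 0) := by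
  by_contra! hno
  have h1 := h.eq_a x
  rw [hx, mul_zero, Finset.sum_eq_single_of_mem y (Finset.mem_univ y)] at h1
  · exact mul_ne_zero (Complex.ofReal_ne_zero.2 (hΓ y))
      (h.symm (hA.resolve_left hxy)) h1.symm
  · intro k _ hky
    by_cases hkx : k = x
    · rw [hkx, h.diag, mul_zero]
    · rw [h.antisymm, (hno k hkx hky).2, neg_zero, mul_zero]

/-- In an uncircled `w`-class `J`, the pairwise products `Γ_j Γ_k` sum to zero. So `J` cannot be
made up, except for at most one vertex `l`, of circled parts of `z`-classes: these have total
vorticity zero since `a` is constant on `J`. -/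
theorem not_decomposed (h : IsHalfLimit Γ Λ a b A B) (h' : IsHalfLimit Γ M b a B A)
    (hΓ : ∀ j, Γ j ≠ 0) {x l : Fin N} (hnt : ∃ y, y ≠ x ∧ y ∈ cls B x)
    (hb : ∀ y ∈ cls B x, b y = 0)
    (hl : ∀ y ∈ cls B x, y ≠ l →
      a y ≠ 0 ∧ ∀ t, t ∈ cls A y → a t ≠ 0 → t ∈ cls B x) : False := by
  classical
  obtain ⟨y₀, hy₀, hy₀l⟩ : ∃ y ∈ cls B x, y ≠ l := by
    obtain ⟨y, hyx, hy⟩ := hnt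
    by_cases hyl : y = l
    · exact ⟨x, self_mem_cls x, fun hxl => hyx (hyl.trans hxl.symm)⟩
    · exact ⟨y, hy, hyl⟩
  set J := cls B x with hJ
  have hconst : ∀ y ∈ J, a y = a x := fun y hy => h'.b_eq_of_mem hy
  have hax : a x ≠ 0 := by
    rw [← hconst y₀ hy₀]
    exact (hl y₀ hy₀ hy₀l).1
  let s : Setoid (Fin N) := ⟨_, h.equivalence⟩
  let c : Fin N → Fin N := fun y => (Quotient.mk s y).out
  have hc : ∀ i j, c i = c j ↔ j ∈ cls A i := by
    intro i j
    rw [mem_cls]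
    exact Quotient.out_inj.trans Quotient.eq
  have hfib : ∀ y ∈ J, y ≠ l → ∑ m ∈ J with c m = c y, Γ m = 0 := by
    intro y hy hyl
    refine h.sum_circled_eq_zero (x := y) hax (fun t => ?_)
      (fun t ht => hconst t (Finset.mem_filter.1 ht).1)
    rw [Finset.mem_filter, eq_comm, hc]
    refine ⟨fun ⟨ht, hty⟩ => ⟨hty, by rwa [hconst t ht]⟩,
      fun ⟨hty, hat⟩ => ⟨(hl y hy hyl).2 t hty hat, hty⟩⟩
  have hsq := h'.sq_sum_of_not_circled hb
  rw [← hJ] at hsq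
  have hdec : ∑ k ∈ J, Γ k = ∑ i ∈ J.image c, ∑ m ∈ J with c m = i, Γ m :=
    (Finset.sum_fiberwise_of_maps_to (fun i hi => Finset.mem_image_of_mem c hi) _).symm
  -- only the fiber of `l` can contribute, and if it does, it consists of `l` alone
  have hcases : ∑ k ∈ J, Γ k = 0 ∨ (l ∈ J ∧ ∑ k ∈ J, Γ k = Γ l) := by
    by_cases hl0 : l ∈ J ∧ ∑ m ∈ J with c m = c l, Γ m ≠ 0
    · refine Or.inr ⟨hl0.1, ?_⟩
      have hone : ∀ y ∈ J, c y = c l → y = l := by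
        intro y hy hyl
        by_contra hne
        apply hl0.2
        rw [← hyl]
        exact hfib y hy hne
      rw [hdec, Finset.sum_eq_single_of_mem (c l) (Finset.mem_image_of_mem c hl0.1)]
      · refine Finset.sum_eq_single_of_mem l (Finset.mem_filter.2 ⟨hl0.1, rfl⟩) ?_
        intro y hy hne
        rw [Finset.mem_filter] at hy
        exact absurd (hone y hy.1 hy.2) hne
      · intro i hi hil
        obtain ⟨y, hy, rfl⟩ := Finset.mem_image.1 hi
        exact hfib y hy (by rintro rfl; exact hil rfl)
    · refine Or.inl ?_
      rw [hdec]
      refine Finset.sum_eq_zero fun i hi => ?_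
      obtain ⟨y, hy, rfl⟩ := Finset.mem_image.1 hi
      by_cases hyl : y = l
      · subst hyl
        by_contra hne
        exact hl0 ⟨hy, hne⟩
      · exact hfib y hy hyl
  have hpos : 0 < Γ y₀ ^ 2 := by
    have := hΓ y₀
    positivity
  rcases hcases with h0 | ⟨hlJ, h0⟩
  · rw [h0] at hsq
    have := Finset.single_le_sum (f := fun k => Γ k ^ 2) (fun k _ => sq_nonneg _) hy₀
    linarith
  · rw [h0, ← Finset.add_sum_erase J (fun k => Γ k ^ 2) hlJ] at hsq
    have := Finset.single_le_sum (f := fun k => Γ k ^ 2) (s := J.erase l)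
      (fun k _ => sq_nonneg _) (Finset.mem_erase.2 ⟨hy₀l, hy₀⟩)
    linarith

/-- Uncircled classes of different colors cannot differ by a single vertex: subtracting the two
equations `∑_{j < k} Γ_j Γ_k = 0`, the smaller one would have total vorticity zero. -/
theorem not_nested (h : IsHalfLimit Γ Λ a b A B) (h' : IsHalfLimit Γ M b a B A)
    (hΓ : ∀ j, Γ j ≠ 0) {x l : Fin N} (ha : ∀ y ∈ cls A x, a y = 0)
    (hb : ∀ y ∈ cls B x, b y = 0) (hAB : ∀ y ∈ cls A x, y ∈ cls B x) (hl : l ∈ cls B x)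
    (hl' : l ∉ cls A x) (hBA : ∀ y ∈ cls B x, y = l ∨ y ∈ cls A x) : False := by
  have hins : cls B x = insert l (cls A x) := by
    ext y
    rw [Finset.mem_insert]
    refine ⟨hBA y, ?_⟩
    rintro (rfl | hy)
    · exact hl
    · exact hAB y hy
  have h1 := h.sq_sum_of_not_circled ha
  have h2 := h'.sq_sum_of_not_circled hb
  rw [hins, Finset.sum_insert hl', Finset.sum_insert hl'] at h2
  have h3 : Γ l * ∑ k ∈ cls A x, Γ k = 0 := by linear_combination (h2 - h1) / 2
  rw [(mul_eq_zero.1 h3).resolve_left (hΓ l)] at h1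
  have := Finset.single_le_sum (f := fun k => Γ k ^ 2) (fun k _ => sq_nonneg _)
    (self_mem_cls (A := A) x)
  have hx : 0 < Γ x ^ 2 := by
    have := hΓ x
    positivity
  linarith

/-- Suppose every `w`-circled vertex is `z`-circled, and its `z`-class is contained in its
`w`-class. Then these `z`-classes have total vorticity zero, and the `w`-circled vertices are in
balance. This excludes the case of a single pair, since its two vertices are distinct, and the case
of a union of `w`-classes, by the virial identity. -/
theorem not_balanced (h : IsHalfLimit Γ Λ a b A B) (h' : IsHalfLimit Γ M b a B A)
    (hΓ : ∀ j, Γ j ≠ 0) {x₀ : Fin N} (hx₀ : b x₀ ≠ 0) (hba : ∀ x, b x ≠ 0 → a x ≠ 0)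
    (hAB : ∀ x y, b x ≠ 0 → y ∈ cls A x → y ∈ cls B x)
    (hcase : (∀ x y, b x ≠ 0 → y ∈ cls B x → b y ≠ 0) ∨
      ∃ x y, x ≠ y ∧ y ∈ cls A x ∧ ∀ k, b k ≠ 0 ↔ k = x ∨ k = y) : False := by
  classical
  let s : Setoid (Fin N) := ⟨_, h.equivalence⟩
  let c : Fin N → Fin N := fun y => (Quotient.mk s y).out
  have hc : ∀ i j, c i = c j ↔ j ∈ cls A i := by
    intro i j
    rw [mem_cls]
    exact Quotient.out_inj.trans Quotient.eq
  have hcc : ∀ i, c (c i) = c i := fun i => by simp [c]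
  have hci : ∀ i, i ∈ cls A (c i) := fun i => (hc _ _).1 (hcc i)
  have hci' : ∀ i, c i ∈ cls A i := fun i => (hc _ _).1 (hcc i).symm
  have hbA : ∀ x y, y ∈ cls A x → b y = b x := fun x y => h.b_eq_of_mem
  set S : Finset (Fin N) := Finset.univ.filter fun i => b i ≠ 0 with hSdef
  have hS : ∀ i, i ∈ S ↔ b i ≠ 0 := fun i => by simp [hSdef]
  have hBmem : ∀ i ∈ S, i ∈ cls B (c i) := by
    intro i hi
    refine hAB _ _ ?_ (hci i)
    rw [hbA i (c i) (hci' i)]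
    exact (hS i).1 hi
  have hfib : ∀ i ∈ S, ∑ m ∈ S with c m = c i, Γ m = 0 := by
    intro i hi
    have hbi := (hS i).1 hi
    refine h.sum_circled_eq_zero (x := i) (hba i hbi) (fun t => ?_) fun t ht => ?_
    · rw [Finset.mem_filter, eq_comm, hc]
      refine ⟨fun ⟨ht, hti⟩ => ⟨hti, hba t ((hS t).1 ht)⟩, fun ⟨hti, _⟩ => ⟨(hS t).2 ?_, hti⟩⟩
      rwa [hbA i t hti]
    · rw [Finset.mem_filter, eq_comm, hc] at ht
      exact h'.b_eq_of_mem (hAB i t hbi ht.2)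
  have hfibC : ∀ i ∈ S, ∑ m ∈ S with c m = c i, (Γ m : ℂ) = 0 := fun i hi => by
    exact_mod_cast hfib i hi
  have hbal := h.balance S c hS
    (fun i hi => by
      by_cases hne : c i = i
      · exact Or.inl hne
      · exact Or.inr ⟨(mem_cls.1 (hci i)).resolve_left hne,
          (mem_cls.1 (hBmem i hi)).resolve_left hne⟩)
    (fun i j hA => (hc i j).2 (mem_cls.2 (Or.inr hA))) hfibC
  rcases hcase with hunion | ⟨x, y, hxy, hyA, hpair⟩
  · -- pass from the representatives `c` of the `z`-classes to representatives of the `w`-classes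
    let s' : Setoid (Fin N) := ⟨_, h'.equivalence⟩
    let d : Fin N → Fin N := fun y => (Quotient.mk s' y).out
    have hd : ∀ i j, d i = d j ↔ j ∈ cls B i := by
      intro i j
      rw [mem_cls]
      exact Quotient.out_inj.trans Quotient.eq
    have hdd : ∀ i, d (d i) = d i := fun i => by simp [d]
    have hdi : ∀ i, i ∈ cls B (d i) := fun i => (hd _ _).1 (hdd i)
    have hdc : ∀ i ∈ S, d (c i) = d i := fun i hi => (hd _ _).2 (hBmem i hi)
    have hinv : ∀ i ∈ S, (B (d i) i)⁻¹ = (B (d i) (c i))⁻¹ + (B (c i) i)⁻¹ := by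
      intro i hi
      rcases mem_cls.1 (hBmem i hi) with h1 | h1
      · rw [h1, h'.diag, inv_zero, add_zero]
      · have h2 := hdi (c i)
        rw [hdc i hi, mem_cls] at h2
        rcases h2 with h2 | h2
        · rw [h2, h'.diag, inv_zero, zero_add]
        · by_cases h3 : d i = i
          · rw [h3, h'.diag, h'.antisymm (c i) i, inv_neg, inv_zero]
            ring
          · exact (h'.cocycle _ _ _ h2 h1 h3).2
    have hbal' : ∑ i ∈ S, (Γ i : ℂ) * (b i * (B (d i) i)⁻¹) = 0 := by
      have h1 : ∑ i ∈ S, (Γ i : ℂ) * (b (c i) * (B (d (c i)) (c i))⁻¹) = 0 :=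
        sum_mul_comp_eq_zero S c (fun i => (Γ i : ℂ)) hfibC fun k => b k * (B (d k) k)⁻¹
      rw [← add_zero (0 : ℂ)]
      nth_rewrite 1 [← h1]
      rw [← hbal, ← Finset.sum_add_distrib]
      refine Finset.sum_congr rfl fun i hi => ?_
      rw [hinv i hi, hdc i hi, hbA i (c i) (hci' i)]
      ring
    have hvir : ∀ i ∈ S, 2 * (M * ∑ k ∈ S with d k = d i, (Γ k : ℂ) * (b k * (B (d k) k)⁻¹)) =
        ((-∑ k ∈ S with d k = d i, Γ k ^ 2 : ℝ) : ℂ) := by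
      intro i hi
      have hcl : (S.filter fun k => d k = d i) = cls B (d i) := by
        ext k
        rw [Finset.mem_filter, ← hd, hdd, eq_comm (a := d i)]
        refine ⟨And.right, fun hk => ⟨(hS k).2 ?_, hk⟩⟩
        exact hunion i k ((hS i).1 hi) ((hd _ _).1 hk.symm)
      have hzero : ∑ k ∈ S with d k = d i, Γ k = 0 := by
        have h1 := sum_mul_comp_eq_zero S c (fun i => (Γ i : ℂ)) hfibC
          fun k => if d k = d i then 1 else 0
        rw [Finset.sum_congr rfl fun k hk => by rw [hdc k hk, mul_ite, mul_one, mul_zero],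
          ← Finset.sum_filter] at h1
        exact_mod_cast h1
      have h1 := h'.virial (d i)
      rw [← hcl, hzero] at h1
      rw [Finset.sum_congr rfl fun k hk => by rw [(Finset.mem_filter.1 hk).2], h1]
      congr 1
      ring
    have h1 : ∑ i ∈ S, (Γ i : ℂ) * (b i * (B (d i) i)⁻¹) = ∑ j ∈ S.image d,
        ∑ k ∈ S with d k = j, (Γ k : ℂ) * (b k * (B (d k) k)⁻¹) :=
      (Finset.sum_fiberwise_of_maps_to (fun i hi => Finset.mem_image_of_mem d hi) _).symm
    have h2 : ∑ i ∈ S, Γ i ^ 2 = ∑ j ∈ S.image d, ∑ k ∈ S with d k = j, Γ k ^ 2 :=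
      (Finset.sum_fiberwise_of_maps_to (fun i hi => Finset.mem_image_of_mem d hi) _).symm
    have h3 : ((-∑ i ∈ S, Γ i ^ 2 : ℝ) : ℂ) = 0 := by
      rw [h2, ← Finset.sum_neg_distrib, Complex.ofReal_sum]
      rw [h1] at hbal'
      rw [← mul_zero 2, ← mul_zero M, ← hbal', Finset.mul_sum, Finset.mul_sum]
      refine Finset.sum_congr rfl fun j hj => ?_
      obtain ⟨i, hi, rfl⟩ := Finset.mem_image.1 hj
      exact (hvir i hi).symm
    have h4 := Complex.ofReal_eq_zero.1 h3
    have h5 := Finset.single_le_sum (f := fun k => Γ k ^ 2) (fun k _ => sq_nonneg _)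
      ((hS x₀).2 hx₀)
    have h6 : 0 < Γ x₀ ^ 2 := by
      have := hΓ x₀
      positivity
    linarith
  · have hSxy : S = {x, y} := by
      ext k
      simp [hS, hpair]
    rw [hSxy, Finset.sum_pair hxy] at hbal
    have hcxy : c x = c y := (hc x y).2 hyA
    have hbx : b x ≠ 0 := (hpair x).2 (Or.inl rfl)
    have hby : b y ≠ 0 := (hpair y).2 (Or.inr rfl)
    have hterm : ∀ i, b i ≠ 0 → c i ≠ i → (Γ i : ℂ) * (b i * (B (c i) i)⁻¹) ≠ 0 := by
      intro i hi hne
      exact mul_ne_zero (Complex.ofReal_ne_zero.2 (hΓ i)) (mul_ne_zero hi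
        (inv_ne_zero ((mem_cls.1 (hBmem i ((hS i).2 hi))).resolve_left hne)))
    have hcx : c x = x ∨ c x = y := by
      refine (hpair _).1 ?_
      rwa [hbA x (c x) (hci' x)]
    rcases hcx with hcx | hcx
    · rw [hcx, h'.diag, inv_zero, mul_zero, mul_zero, zero_add] at hbal
      exact hterm y hby (by rw [← hcxy, hcx]; exact hxy) hbal
    · rw [← hcxy, hcx, h'.diag, inv_zero, mul_zero, mul_zero, add_zero, ← hcx] at hbal
      exact hterm x hbx (by rw [hcx]; exact hxy.symm) hbal

end IsHalfLimit

/-! ### The limits of a singular sequence -/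

/-- After rescaling, a sequence is of the order of the scale iff its limit is not zero. -/
theorem isTheta_iff_of_tendsto {f : ℕ → ℂ} {R : ℕ → ℝ} {ℓ : ℂ} (hR : Tendsto R atTop atTop)
    (hf : Tendsto (fun n => (R n)⁻¹ • f n) atTop (𝓝 ℓ)) : f =Θ[atTop] R ↔ ℓ ≠ 0 := by
  have hR0 : ∀ᶠ n in atTop, R n ≠ 0 := hR.eventually_ne_atTop 0
  have hfR : f =ᶠ[atTop] fun n => R n • ((R n)⁻¹ • f n) := by
    filter_upwards [hR0] with n hn
    rw [smul_inv_smul₀ hn]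
  constructor
  · rintro hΘ rfl
    have h1 : f =o[atTop] R := by
      have h2 := (isBigO_refl R atTop).smul_isLittleO ((isLittleO_one_iff ℝ).2 hf)
      simpa using hfR.trans_isLittleO h2
    have h3 := hΘ.2.trans_isLittleO h1
    exact isLittleO_irrefl' (hR0.mono fun n hn => norm_ne_zero_iff.2 hn).frequently h3
  · intro hℓ
    have h1 : (fun n => (R n)⁻¹ • f n) =Θ[atTop] fun _ => (1 : ℝ) :=
      ((isEquivalent_const_iff_tendsto hℓ).2 hf).isTheta.trans
        (isTheta_const_const hℓ one_ne_zero)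
    have h2 := (isTheta_refl R atTop).smul h1
    simpa using hfR.trans_isTheta h2

/-- The limits of a singular sequence satisfy the relations of both colors, and the diagram can be
read off from them. -/
theorem IsSingularSequence.exists_limits {N : ℕ} {Γ : Fin N → ℝ} {Λ : ℕ → ℂ}
    {Q : ℕ → ExtendedConfiguration N} (h : IsSingularSequence Γ Λ Q) :
    ∃ (F : Filter ℕ) (_ : F.NeBot) (r : ℕ → ℂ) (Λ₁ Λ₂ : ℂ) (a b : Fin N → ℂ)
      (A B : Fin N → Fin N → ℂ),
      RescaledLimit F Γ Λ r (fun n => (Q n).z) (fun n => (Q n).w) (fun n => (Q n).Z)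
        (fun n => (Q n).W) Λ₁ a b A B ∧
      RescaledLimit F Γ (fun n => (starRingEnd ℂ) (Λ n)) r (fun n => (Q n).w) (fun n => (Q n).z)
        (fun n => (Q n).W) (fun n => (Q n).Z) Λ₂ b a B A ∧
      (∃ j k, A j k ≠ 0) ∧ (∃ j k, B j k ≠ 0) ∧
      (∀ j k, (ofSequence Q).zStrokes.Adj j k ↔ A j k ≠ 0) ∧
      (∀ j k, (ofSequence Q).wStrokes.Adj j k ↔ B j k ≠ 0) ∧
      (∀ k, k ∈ (ofSequence Q).zCircles ↔ a k ≠ 0) ∧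
      (∀ k, k ∈ (ofSequence Q).wCircles ↔ b k ≠ 0) := by
  obtain ⟨⟨a, A⟩, hzlim⟩ := h.z_converges
  obtain ⟨⟨b, B⟩, hwlim⟩ := h.w_converges
  have hR := h.tendsto_norm
  have hRw : Tendsto (fun n => ‖(Q n).wVec‖) atTop atTop :=
    hR.congr fun n => (h.isCC n).norm_eq
  have ha : ∀ k, Tendsto (fun n => ‖(Q n).zVec‖⁻¹ • (Q n).z k) atTop (𝓝 (a k)) := fun k =>
    ((continuous_apply k).comp continuous_fst).continuousAt.tendsto.comp hzlim
  have hA : ∀ j k, Tendsto (fun n => ‖(Q n).zVec‖⁻¹ • (Q n).Z j k) atTop (𝓝 (A j k)) := fun j k =>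
    ((continuous_apply_apply j k).comp continuous_snd).continuousAt.tendsto.comp hzlim
  have hb : ∀ k, Tendsto (fun n => ‖(Q n).wVec‖⁻¹ • (Q n).w k) atTop (𝓝 (b k)) := fun k =>
    ((continuous_apply k).comp continuous_fst).continuousAt.tendsto.comp hwlim
  have hB : ∀ j k, Tendsto (fun n => ‖(Q n).wVec‖⁻¹ • (Q n).W j k) atTop (𝓝 (B j k)) := fun j k =>
    ((continuous_apply_apply j k).comp continuous_snd).continuousAt.tendsto.comp hwlim
  have hb' : ∀ k, Tendsto (fun n => ‖(Q n).zVec‖⁻¹ • (Q n).w k) atTop (𝓝 (b k)) := fun k =>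
    (hb k).congr fun n => by rw [(h.isCC n).norm_eq]
  have hB' : ∀ j k, Tendsto (fun n => ‖(Q n).zVec‖⁻¹ • (Q n).W j k) atTop (𝓝 (B j k)) :=
    fun j k => (hB j k).congr fun n => by rw [(h.isCC n).norm_eq]
  have hunit : ∀ (v : ℕ → (Fin N → ℂ) × (Fin N → Fin N → ℂ)) l,
      Tendsto (fun n => ‖v n‖) atTop atTop → Tendsto (fun n => ‖v n‖⁻¹ • v n) atTop (𝓝 l) →
      l ≠ 0 := by
    rintro v l hv hl rfl
    have h1 : Tendsto (fun n => ‖‖v n‖⁻¹ • v n‖) atTop (𝓝 1) := by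
      refine tendsto_const_nhds.congr' ?_
      filter_upwards [hv.eventually_ne_atTop 0] with n hn
      rw [norm_smul, norm_inv, norm_norm, inv_mul_cancel₀ hn]
    have h2 := tendsto_nhds_unique h1 hl.norm
    simp at h2
  -- only the multipliers need not converge; an ultrafilter provides a limit
  let U : Ultrafilter ℕ := Ultrafilter.of atTop
  have hU : (U : Filter ℕ) ≤ atTop := Ultrafilter.of_le atTop
  obtain ⟨Λ₁, hΛ₁, hΛlim⟩ : ∃ Λ₁ ∈ Metric.sphere (0 : ℂ) 1, Tendsto Λ U (𝓝 Λ₁) := by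
    have hmem : ∀ n, Λ n ∈ Metric.sphere (0 : ℂ) 1 := fun n => by
      simpa using (h.isCC n).norm_multiplier
    exact (isCompact_sphere (0 : ℂ) 1).ultrafilter_le_nhds (U.map Λ)
      (le_principal_iff.2 (Filter.mem_map.2 (univ_mem' hmem)))
  have hΛ₁ne : Λ₁ ≠ 0 := by
    rintro rfl
    simp at hΛ₁
  have hdiag : ∀ (f : Fin N → Fin N → ℂ), (∀ j k, f j k = -f k j) → ∀ k,
      ∑ j ∈ Finset.univ.erase k, (Γ j : ℂ) * f j k = ∑ j, (Γ j : ℂ) * f j k := by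
    intro f hf k
    refine Finset.sum_erase _ ?_
    rw [self_eq_neg.1 (hf k k), mul_zero]
  have hr : ∀ n, ((‖(Q n).zVec‖ : ℝ) : ℂ)⁻¹ = ((‖(Q n).zVec‖⁻¹ : ℝ) : ℂ) := fun n => by
    rw [Complex.ofReal_inv]
  have hrne : ∀ᶠ n in (U : Filter ℕ), ((‖(Q n).zVec‖ : ℝ) : ℂ) ≠ 0 := by
    filter_upwards [hU (hR.eventually_ne_atTop 0)] with n hn
    exact Complex.ofReal_ne_zero.2 hn
  have hrinv : Tendsto (fun n => ((‖(Q n).zVec‖ : ℝ) : ℂ)⁻¹) U (𝓝 0) := by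
    simp_rw [hr]
    exact (Complex.continuous_ofReal.tendsto' 0 0 Complex.ofReal_zero).comp
      (hR.inv_tendsto_atTop.mono_left hU)
  have hz : RescaledLimit U Γ Λ (fun n => ((‖(Q n).zVec‖ : ℝ) : ℂ)) (fun n => (Q n).z)
      (fun n => (Q n).w) (fun n => (Q n).Z) (fun n => (Q n).W) Λ₁ a b A B :=
    { eq_z := fun n k => ((h.isCC n).eq_z k).trans (hdiag _ (h.isCC n).Z_antisymm k)
      Z_mul := fun n => (h.isCC n).Z_mul
      W_mul := fun n => (h.isCC n).W_mul
      Z_antisymm := fun n => (h.isCC n).Z_antisymm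
      W_antisymm := fun n => (h.isCC n).W_antisymm
      scale_ne := hrne
      scale_inv := hrinv
      tendsto_Λ := hΛlim
      Λ_ne := hΛ₁ne
      tendsto_z := fun k => by
        simpa only [hr, Complex.real_smul] using (ha k).mono_left hU
      tendsto_w := fun k => by
        simpa only [hr, Complex.real_smul] using (hb' k).mono_left hU
      tendsto_Z := fun j k => by
        simpa only [hr, Complex.real_smul] using (hA j k).mono_left hU
      tendsto_W := fun j k => by
        simpa only [hr, Complex.real_smul] using (hB' j k).mono_left hU }
  have hw : RescaledLimit U Γ (fun n => (starRingEnd ℂ) (Λ n)) (fun n => ((‖(Q n).zVec‖ : ℝ) : ℂ))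
      (fun n => (Q n).w) (fun n => (Q n).z) (fun n => (Q n).W) (fun n => (Q n).Z)
      ((starRingEnd ℂ) Λ₁) b a B A :=
    { eq_z := fun n k => ((h.isCC n).eq_w k).trans (hdiag _ (h.isCC n).W_antisymm k)
      Z_mul := hz.W_mul
      W_mul := hz.Z_mul
      Z_antisymm := hz.W_antisymm
      W_antisymm := hz.Z_antisymm
      scale_ne := hrne
      scale_inv := hrinv
      tendsto_Λ := (Complex.continuous_conj.tendsto _).comp hΛlim
      Λ_ne := by simpa using hΛ₁ne
      tendsto_z := hz.tendsto_w
      tendsto_w := hz.tendsto_z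
      tendsto_Z := hz.tendsto_W
      tendsto_W := hz.tendsto_Z }
  have hstroke : ∀ {Λ' : ℂ} {a' b' : Fin N → ℂ} {A' B' : Fin N → Fin N → ℂ},
      IsHalfLimit Γ Λ' a' b' A' B' → (a', A') ≠ 0 → ∃ j k, A' j k ≠ 0 := by
    intro Λ' a' b' A' B' h' hne
    by_contra! h0
    refine hne (Prod.ext (funext fun k => ?_) (funext fun j => funext fun k => h0 j k))
    have := h'.eq_a k
    simp only [h0, mul_zero, Finset.sum_const_zero] at this
    exact (mul_eq_zero.1 this).resolve_left h'.Λ_ne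
  have hadj : ∀ {A' : Fin N → Fin N → ℂ} {f : Fin N → Fin N → ℕ → ℂ} {R : ℕ → ℝ},
      (∀ j k, A' j k = -A' k j) → (∀ j k, f j k =Θ[atTop] R ↔ A' j k ≠ 0) →
      ∀ j k, (SimpleGraph.fromRel fun j k => f j k =Θ[atTop] R).Adj j k ↔ A' j k ≠ 0 := by
    intro A' f R hanti hf j k
    rw [SimpleGraph.fromRel_adj, hf, hf, hanti k j, neg_ne_zero, or_self]
    refine ⟨And.right, fun hA' => ⟨?_, hA'⟩⟩
    rintro rfl
    exact hA' (self_eq_neg.1 (hanti j j))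
  refine ⟨U, inferInstance, _, Λ₁, _, a, b, A, B, hz, hw,
    hstroke hz.isHalfLimit (hunit _ _ hR hzlim), hstroke hw.isHalfLimit (hunit _ _ hRw hwlim),
    hadj hz.antisymm fun j k => isTheta_iff_of_tendsto hR (hA j k),
    hadj hw.antisymm fun j k => isTheta_iff_of_tendsto hRw (hB j k),
    fun k => isTheta_iff_of_tendsto hR (ha k), fun k => isTheta_iff_of_tendsto hRw (hb k)⟩

/-! ### Combinatorial rules and codes of diagrams -/

/-- The conditions that relate the circles `cz` of one color to the strokes of the same color: no
circle is alone in its component, and a vertex of only one stroke is circled. Here and below, the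
strokes are given by the equivalence relation of lying in the same component. -/
def CircleRule (Ez : Fin 5 → Fin 5 → Bool) (cz : Fin 5 → Bool) : Prop :=
  (∀ x, cz x → ∃ y, y ≠ x ∧ Ez x y ∧ cz y) ∧
  ∀ x y, x ≠ y → Ez x y → cz x = false → ∃ k, k ≠ x ∧ k ≠ y ∧ Ez x k

/-- The circles of one color are constant on the components of the other color. -/
def ConstantRule (Ew : Fin 5 → Fin 5 → Bool) (cz : Fin 5 → Bool) : Prop :=
  ∀ x y, Ew x y → cz x = cz y

/-- A `w`-class without `w`-circles does not consist of `z`-circled parts of `z`-classes, up to one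
vertex. -/
def DecompositionRule (Ez Ew : Fin 5 → Fin 5 → Bool) (cz cw : Fin 5 → Bool) : Prop :=
  ∀ x l, (∃ y, y ≠ x ∧ Ew x y) → (∀ y, Ew x y → cw y = false) →
    ¬ ∀ y, Ew x y → y ≠ l → cz y ∧ ∀ t, Ez y t → cz t → Ew x t

/-- Two classes of different colors, each without circles of its color, do not differ by exactly one
vertex. -/
def NestingRule (Ez Ew : Fin 5 → Fin 5 → Bool) (cz cw : Fin 5 → Bool) : Prop :=
  ∀ x l, (∀ y, Ez x y → cz y = false) → (∀ y, Ez x y → Ew x y) → (∀ y, Ew x y → cw y = false) →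
    Ew x l → ¬ Ez x l → ¬ ∀ y, Ew x y → y = l ∨ Ez x y

/-- If the `w`-circled vertices are `z`-circled and their `z`-classes are contained in their
`w`-classes, then they neither form a single pair nor a union of `w`-classes. -/
def BalanceRule (Ez Ew : Fin 5 → Fin 5 → Bool) (cz cw : Fin 5 → Bool) : Prop :=
  ∀ x₀, cw x₀ → (∀ x, cw x → cz x) → (∀ x y, cw x → Ez x y → Ew x y) →
    ¬ ((∀ x y, cw x → Ew x y → cw y) ∨ ∃ x y, x ≠ y ∧ Ez x y ∧ ∀ k, cw k ↔ k = x ∨ k = y)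

/-- The necessary conditions of one color that involve the circles of both colors. -/
def ClassRule (Ez Ew : Fin 5 → Fin 5 → Bool) (cz cw : Fin 5 → Bool) : Prop :=
  DecompositionRule Ez Ew cz cw ∧ NestingRule Ez Ew cz cw ∧ BalanceRule Ez Ew cz cw

instance (Ez : Fin 5 → Fin 5 → Bool) (cz : Fin 5 → Bool) : Decidable (CircleRule Ez cz) := by
  unfold CircleRule
  infer_instance

instance (Ew : Fin 5 → Fin 5 → Bool) (cz : Fin 5 → Bool) : Decidable (ConstantRule Ew cz) := by
  unfold ConstantRule
  infer_instance

set_option synthInstance.maxHeartbeats 400000 in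
set_option synthInstance.maxSize 1000 in
instance (Ez Ew : Fin 5 → Fin 5 → Bool) (cz cw : Fin 5 → Bool) :
    Decidable (ClassRule Ez Ew cz cw) := by
  have : Decidable (DecompositionRule Ez Ew cz cw) := by
    unfold DecompositionRule
    infer_instance
  have : Decidable (NestingRule Ez Ew cz cw) := by
    unfold NestingRule
    infer_instance
  have : Decidable (BalanceRule Ez Ew cz cw) := by
    unfold BalanceRule
    infer_instance
  unfold ClassRule
  infer_instance

namespace IsHalfLimit

variable {Γ : Fin 5 → ℝ} {Λ M : ℂ} {a b : Fin 5 → ℂ} {A B : Fin 5 → Fin 5 → ℂ}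
  {Ez Ew : Fin 5 → Fin 5 → Bool} {cz cw : Fin 5 → Bool}

theorem circleRule (h : IsHalfLimit Γ Λ a b A B) (hΓ : ∀ j, Γ j ≠ 0)
    (hEz : ∀ x y, Ez x y ↔ x = y ∨ A x y ≠ 0) (hcz : ∀ x, cz x ↔ a x ≠ 0) : CircleRule Ez cz := by
  refine ⟨fun x hx => ?_, fun x y hxy hE hx => ?_⟩
  · simp only [hEz, hcz] at hx ⊢
    exact h.exists_other_circle hΓ hx
  · rw [hEz] at hE
    rw [← Bool.not_eq_true, hcz, not_not] at hx
    simp only [hEz]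
    exact h.exists_other_stroke hΓ hxy hE hx

theorem constantRule (h : IsHalfLimit Γ Λ a b A B) (hEz : ∀ x y, Ez x y ↔ x = y ∨ A x y ≠ 0)
    (hcw : ∀ x, cw x ↔ b x ≠ 0) : ConstantRule Ez cw := by
  intro x y hE
  rw [hEz, ← mem_cls] at hE
  rw [Bool.eq_iff_iff, hcw, hcw, h.b_eq_of_mem hE]

theorem classRule (h : IsHalfLimit Γ Λ a b A B) (h' : IsHalfLimit Γ M b a B A)
    (hΓ : ∀ j, Γ j ≠ 0) (hEz : ∀ x y, Ez x y ↔ x = y ∨ A x y ≠ 0)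
    (hEw : ∀ x y, Ew x y ↔ x = y ∨ B x y ≠ 0) (hcz : ∀ x, cz x ↔ a x ≠ 0)
    (hcw : ∀ x, cw x ↔ b x ≠ 0) :
    ClassRule Ez Ew cz cw := by
  have hcz' : ∀ x, cz x = false ↔ a x = 0 := fun x => by
    rw [← Bool.not_eq_true, hcz, not_not]
  have hcw' : ∀ x, cw x = false ↔ b x = 0 := fun x => by
    rw [← Bool.not_eq_true, hcw, not_not]
  simp only [ClassRule, DecompositionRule, NestingRule, BalanceRule,
    hEz, hEw, hcz, hcw, hcz', hcw', ← mem_cls]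
  exact ⟨fun x l h1 h2 h3 => h.not_decomposed h' hΓ h1 h2 h3,
    fun x l h1 h2 h3 h4 h5 h6 => h.not_nested h' hΓ h1 h3 h2 h4 h5 h6,
    fun x h1 h2 h3 h4 => h.not_balanced h' hΓ h1 h2 h3 h4⟩

end IsHalfLimit

/-- The position of the unordered pair `{j, k}` of different vertices in the sequence
`{0, 1}, {0, 2}, {1, 2}, {0, 3}, …, {3, 4}`. -/
def pairIndex (j k : Fin 5) : ℕ :=
  if j < k then (k : ℕ) * (k - 1) / 2 + j else (j : ℕ) * (j - 1) / 2 + k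

/-- The reflexive and symmetric relation whose pairs of different vertices are the binary digits
of `m`, in the order of `pairIndex`. -/
def related (m : ℕ) (j k : Fin 5) : Bool := j = k || m.testBit (pairIndex j k)

/-- A two-colored diagram on five vertices, encoded by numbers: the binary digits of `p` and `q` are
the `z`- and the `w`-strokes, those of `c` and `d` are the `z`- and the `w`-circles. -/
structure DiagramCode where
  p : ℕ
  q : ℕ
  c : ℕ
  d : ℕ

namespace DiagramCode

/-- The diagram of a code. -/
def toDiagram (t : DiagramCode) : TwoColoredDiagram 5 where
  zStrokes := SimpleGraph.fromRel fun j k => related t.p j k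
  wStrokes := SimpleGraph.fromRel fun j k => related t.q j k
  zCircles := {k | t.c.testBit k}
  wCircles := {k | t.d.testBit k}

/-- The code of the diagram with the two colors exchanged. -/
def swap (t : DiagramCode) : DiagramCode := ⟨t.q, t.p, t.d, t.c⟩

/-- The renumbering `σ` of the vertices turns the diagram of `s` into the diagram of `t`. -/
def Matches (s t : DiagramCode) (σ : Fin 5 → Fin 5) : Prop :=
  (∀ j k, related s.p j k = related t.p (σ j) (σ k)) ∧
  (∀ j k, related s.q j k = related t.q (σ j) (σ k)) ∧
  (∀ k : Fin 5, s.c.testBit k = t.c.testBit (σ k)) ∧ ∀ k : Fin 5, s.d.testBit k = t.d.testBit (σ k)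

instance (s t : DiagramCode) (σ : Fin 5 → Fin 5) : Decidable (s.Matches t σ) := by
  unfold Matches
  infer_instance

/-- The contribution of the vertex `x` to the invariant `hash`. -/
def weight (t : DiagramCode) (x : Fin 5) : ℕ :=
  ∑ y, ((related t.p x y).toNat + (related t.q x y).toNat +
    (related t.p x y && related t.q x y).toNat) + (t.c.testBit x).toNat + 2 * (t.d.testBit x).toNat

/-- A number that does not depend on the numbering of the vertices. -/
def hash (t : DiagramCode) : ℕ := ∑ x, t.weight x ^ 3

end DiagramCode

/-- The codes of the diagrams in `possibleDiagrams`. -/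
def possibleCodes : ℕ → List DiagramCode
  | 0 => [⟨512, 4, 24, 6⟩, ⟨512, 7, 24, 0⟩, ⟨512, 7, 24, 3⟩, ⟨512, 7, 24, 7⟩]
  | 2 => [⟨516, 272, 30, 30⟩]
  | 4 => [⟨800, 800, 0, 0⟩, ⟨800, 801, 0, 3⟩, ⟨801, 801, 31, 31⟩, ⟨800, 52, 0, 0⟩,
      ⟨800, 658, 0, 31⟩, ⟨801, 658, 31, 31⟩, ⟨800, 7, 0, 0⟩, ⟨800, 7, 0, 3⟩, ⟨800, 7, 24, 3⟩,
      ⟨801, 519, 31, 31⟩]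
  | 5 => [⟨800, 948, 0, 30⟩, ⟨948, 801, 28, 31⟩, ⟨800, 63, 0, 0⟩, ⟨800, 63, 0, 3⟩,
      ⟨948, 519, 0, 31⟩]
  | 6 => [⟨948, 948, 0, 0⟩, ⟨800, 1023, 0, 29⟩, ⟨800, 1023, 0, 31⟩, ⟨800, 1023, 0, 0⟩,
      ⟨800, 1023, 0, 3⟩, ⟨801, 1023, 31, 28⟩, ⟨801, 1023, 31, 31⟩, ⟨948, 63, 0, 0⟩]
  | 7 => [⟨948, 1023, 0, 31⟩]
  | 8 => [⟨1023, 1023, 0, 0⟩, ⟨1023, 1023, 31, 31⟩]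
  | _ => []

/-- The codes of all possible diagrams, in one list. -/
def allPossibleCodes : List DiagramCode := (List.range 9).flatMap possibleCodes

/-- The codes of the diagrams in `excludedDiagrams`. -/
def excludedCodes : List DiagramCode :=
  [⟨516, 516, 30, 30⟩, ⟨800, 516, 0, 30⟩, ⟨800, 516, 24, 30⟩, ⟨800, 800, 28, 28⟩,
    ⟨800, 801, 28, 31⟩, ⟨516, 948, 30, 30⟩, ⟨948, 519, 0, 30⟩, ⟨948, 948, 30, 30⟩]

/-- The codes of the equivalence relations on five vertices that are not the equality. -/
def equivalenceCodes : List ℕ :=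
  [1, 2, 4, 7, 8, 12, 16, 18, 25, 32, 33, 42, 52, 63, 64, 68, 80, 96, 116, 128, 130, 136, 160, 170,
    193, 225, 256, 257, 264, 272, 281, 322, 338, 388, 396, 455, 512, 513, 514, 516, 519, 584, 588,
    656, 658, 729, 800, 801, 874, 948, 1023]

/-- One code for each type of equivalence relation that is not the equality: the classes with more
than one element are `34`; `12, 34`; `234`; `01, 234`; `1234`; `01234`. -/
def canonicalCodes : List ℕ := [512, 516, 800, 801, 948, 1023]

/-- The map whose value at `k` is the digit of `n` at `5 ^ k` in base five. -/
def digit (n : ℕ) (k : Fin 5) : Fin 5 := ⟨n / 5 ^ (k : ℕ) % 5, Nat.mod_lt _ (by decide)⟩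

/-- The numbers with five different digits in base five: these encode the renumberings. -/
def renumberings : List ℕ :=
  [194, 198, 214, 222, 238, 242, 294, 298, 334, 346, 358, 366, 414, 422, 434, 446, 482, 486,
    538, 542, 558, 566, 582, 586, 694, 698, 714, 722, 738, 742, 894, 898, 954, 970, 978, 990,
    1014, 1022, 1054, 1070, 1102, 1110, 1138, 1142, 1178, 1190, 1202, 1210, 1294, 1298, 1334,
    1346, 1358, 1366, 1394, 1398, 1454, 1470, 1478, 1490, 1634, 1646, 1654, 1670, 1726, 1730,
    1758, 1766, 1778, 1790, 1826, 1830, 1914, 1922, 1934, 1946, 1982, 1986, 2014, 2022, 2054,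
    2070, 2102, 2110, 2134, 2146, 2154, 2170, 2226, 2230, 2382, 2386, 2402, 2410, 2426, 2430,
    2538, 2542, 2558, 2566, 2582, 2586, 2638, 2642, 2678, 2690, 2702, 2710, 2758, 2766, 2778,
    2790, 2826, 2830, 2882, 2886, 2902, 2910, 2926, 2930]

/-! ### The finite verification -/

theorem injective_digit : ∀ n ∈ renumberings, Function.Injective (digit n) := by
  decide +kernel

theorem mem_equivalenceCodes : ∀ m < 1024,
    (∀ j k l, related m j k → related m k l → related m j l) → m ≠ 0 → m ∈ equivalenceCodes := by
  decide +kernel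

/-- The equality of the hashes is redundant, but it spares the search among the renumberings in most
cases. -/
theorem exists_canonicalCode : ∀ m ∈ equivalenceCodes, ∃ p ∈ canonicalCodes,
    (DiagramCode.mk p 0 0 0).hash = (DiagramCode.mk m 0 0 0).hash ∧ ∃ n ∈ renumberings,
      ∀ j k, related p j k = related m (digit n j) (digit n k) := by
  decide +kernel

namespace DiagramCode

/-- Up to a renumbering of the vertices and an exchange of the colors, `s` is the code of a possible
diagram. The equality of the hashes is redundant, but it speeds up the decision. -/
def IsPossible (s : DiagramCode) : Prop :=
  ∃ t ∈ allPossibleCodes ++ allPossibleCodes.map swap, t.hash = s.hash ∧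
    ∃ n ∈ renumberings, s.Matches t (digit n)

instance (s : DiagramCode) : Decidable s.IsPossible := by
  unfold IsPossible
  infer_instance

set_option synthInstance.maxHeartbeats 400000 in
set_option synthInstance.maxSize 1000 in
/-- The finite verification: every diagram that obeys the rules of both colors is a possible one,
where the `z`-strokes may be assumed to be in canonical position. -/
theorem isPossible_of_rules : ∀ p ∈ canonicalCodes, ∀ c < 32,
    CircleRule (related p) (fun k => c.testBit k) → ∀ q ∈ equivalenceCodes,
    ConstantRule (related q) (fun k => c.testBit k) → ∀ d < 32,
    ConstantRule (related p) (fun k => d.testBit k) →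
    CircleRule (related q) (fun k => d.testBit k) →
    ClassRule (related p) (related q) (fun k => c.testBit k) (fun k => d.testBit k) →
    ClassRule (related q) (related p) (fun k => d.testBit k) (fun k => c.testBit k) →
    IsPossible ⟨p, q, c, d⟩ := by
  decide +kernel

end DiagramCode

/-! ### Equivalence of diagrams and the two lists -/

namespace TwoColoredDiagram

variable {N : ℕ} {D E F : TwoColoredDiagram N}

theorem Iso.symm (h : D.Iso E) : E.Iso D := by
  obtain ⟨σ, hz, hw, hcz, hcw⟩ := h
  refine ⟨σ.symm, fun j k => ?_, fun j k => ?_, fun k => ?_, fun k => ?_⟩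
  · rw [hz, σ.apply_symm_apply, σ.apply_symm_apply]
  · rw [hw, σ.apply_symm_apply, σ.apply_symm_apply]
  · rw [hcz, σ.apply_symm_apply]
  · rw [hcw, σ.apply_symm_apply]

theorem Iso.trans (h : D.Iso E) (h' : E.Iso F) : D.Iso F := by
  obtain ⟨σ, hz, hw, hcz, hcw⟩ := h
  obtain ⟨τ, hz', hw', hcz', hcw'⟩ := h'
  exact ⟨σ.trans τ, fun j k => (hz j k).trans (hz' _ _), fun j k => (hw j k).trans (hw' _ _),
    fun k => (hcz k).trans (hcz' _), fun k => (hcw k).trans (hcw' _)⟩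

theorem Iso.swap (h : D.Iso E) : D.swap.Iso E.swap := by
  obtain ⟨σ, hz, hw, hcz, hcw⟩ := h
  exact ⟨σ, hw, hz, hcw, hcz⟩

theorem Equivalent.symm (h : D.Equivalent E) : E.Equivalent D :=
  h.imp Iso.symm fun h => h.symm.swap

theorem Equivalent.trans (h : D.Equivalent E) (h' : E.Equivalent F) : D.Equivalent F := by
  rcases h with h | h <;> rcases h' with h' | h'
  · exact Or.inl (h.trans h')
  · exact Or.inr (h.swap.trans h')
  · exact Or.inr (h.trans h')
  · exact Or.inl (h.swap.trans h')

theorem maxStrokes_swap (D : TwoColoredDiagram N) : D.swap.maxStrokes = D.maxStrokes := by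
  classical
  unfold maxStrokes
  congr 1
  funext k
  have h1 : D.swap.IsBicolored k ↔ D.IsBicolored k := and_comm
  have h2 : D.swap.strokeCount k = D.strokeCount k := Nat.add_comm _ _
  rw [h2]
  exact if_congr h1 rfl rfl

theorem Iso.maxStrokes_eq (h : D.Iso E) : D.maxStrokes = E.maxStrokes := by
  classical
  obtain ⟨σ, hz, hw, -, -⟩ := h
  have hbi : ∀ k, D.IsBicolored k ↔ E.IsBicolored (σ k) := by
    intro k
    unfold IsBicolored
    simp only [hz, hw]
    rw [σ.surjective.exists (p := fun j => E.zStrokes.Adj (σ k) j),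
      σ.surjective.exists (p := fun j => E.wStrokes.Adj (σ k) j)]
  have hcount : ∀ (G H : SimpleGraph (Fin N)), (∀ j k, G.Adj j k ↔ H.Adj (σ j) (σ k)) →
      ∀ k, (G.neighborSet k).ncard = (H.neighborSet (σ k)).ncard := by
    intro G H hGH k
    rw [← Set.ncard_image_of_injective _ σ.injective]
    congr 1
    ext l
    simp only [Set.mem_image, SimpleGraph.mem_neighborSet, hGH]
    refine ⟨?_, fun hl => ⟨σ.symm l, by rwa [σ.apply_symm_apply], σ.apply_symm_apply l⟩⟩
    rintro ⟨j, hj, rfl⟩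
    exact hj
  unfold maxStrokes strokeCount
  simp only [hcount _ _ hz, hcount _ _ hw]
  conv_rhs => rw [← Finset.map_univ_equiv σ, Finset.sup_map]
  exact Finset.sup_congr rfl fun k _ => if_congr (hbi k) rfl rfl

theorem Equivalent.maxStrokes_eq (h : D.Equivalent E) : D.maxStrokes = E.maxStrokes :=
  h.elim Iso.maxStrokes_eq fun h => (maxStrokes_swap D).symm.trans h.maxStrokes_eq

end TwoColoredDiagram

theorem related_self (m : ℕ) (k : Fin 5) : related m k k := by simp [related]

theorem related_comm (m : ℕ) (j k : Fin 5) : related m j k = related m k j := by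
  have h : ∀ j k : Fin 5, j ≠ k → pairIndex j k = pairIndex k j := by decide
  by_cases hjk : j = k
  · rw [hjk]
  · simp [related, hjk, Ne.symm hjk, h j k hjk]

namespace DiagramCode

theorem zStrokes_adj (t : DiagramCode) (j k : Fin 5) :
    t.toDiagram.zStrokes.Adj j k ↔ j ≠ k ∧ related t.p j k := by
  simp [toDiagram, related_comm t.p k j]

theorem wStrokes_adj (t : DiagramCode) (j k : Fin 5) :
    t.toDiagram.wStrokes.Adj j k ↔ j ≠ k ∧ related t.q j k := by
  simp [toDiagram, related_comm t.q k j]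

theorem Matches.iso {s t : DiagramCode} {σ : Equiv.Perm (Fin 5)} (h : s.Matches t σ) :
    s.toDiagram.Iso t.toDiagram := by
  obtain ⟨hz, hw, hcz, hcw⟩ := h
  refine ⟨σ, fun j k => ?_, fun j k => ?_, fun k => ?_, fun k => ?_⟩
  · rw [zStrokes_adj, zStrokes_adj, hz, σ.injective.ne_iff]
  · rw [wStrokes_adj, wStrokes_adj, hw, σ.injective.ne_iff]
  · exact iff_of_eq (congrArg (· = true) (hcz k))
  · exact iff_of_eq (congrArg (· = true) (hcw k))

theorem hash_eq_of_iso {s t : DiagramCode} (h : s.toDiagram.Iso t.toDiagram) :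
    s.hash = t.hash := by
  obtain ⟨σ, hz, hw, hcz, hcw⟩ := h
  have hrel : ∀ {p p' : ℕ}, (∀ j k, j ≠ k ∧ related p j k ↔ σ j ≠ σ k ∧ related p' (σ j) (σ k)) →
      ∀ j k, related p j k = related p' (σ j) (σ k) := by
    intro p p' h j k
    by_cases hjk : j = k
    · rw [hjk, related_self, related_self]
    · have := h j k
      simp only [σ.injective.ne_iff, hjk, ne_eq, not_false_eq_true, true_and] at this
      exact Bool.eq_iff_iff.2 this
  simp only [zStrokes_adj] at hz
  simp only [wStrokes_adj] at hw
  have hcz' : ∀ k : Fin 5, s.c.testBit k = t.c.testBit (σ k) := fun k => Bool.eq_iff_iff.2 (hcz k)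
  have hcw' : ∀ k : Fin 5, s.d.testBit k = t.d.testBit (σ k) := fun k => Bool.eq_iff_iff.2 (hcw k)
  have hweight : ∀ x, s.weight x = t.weight (σ x) := by
    intro x
    unfold weight
    simp only [hrel hz, hrel hw, hcz', hcw']
    rw [Equiv.sum_comp σ fun y => ((related t.p (σ x) y).toNat + (related t.q (σ x) y).toNat +
      (related t.p (σ x) y && related t.q (σ x) y).toNat)]
  unfold hash
  simp only [hweight]
  exact Equiv.sum_comp σ fun x => t.weight x ^ 3

/-- The product of the hashes of a diagram and its color exchange is an invariant of equivalence. -/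
theorem hash_mul_eq_of_equivalent {s t : DiagramCode} (h : s.toDiagram.Equivalent t.toDiagram) :
    s.hash * s.swap.hash = t.hash * t.swap.hash := by
  rcases h with h | h
  · rw [hash_eq_of_iso h, hash_eq_of_iso (s := s.swap) (t := t.swap) h.swap]
  · rw [hash_eq_of_iso (s := s.swap) h, hash_eq_of_iso (s := s) (t := t.swap) h.swap, mul_comm]

/-- The maximal number of strokes at a bicolored vertex, computed from the code. -/
def maxStrokes (t : DiagramCode) : ℕ :=
  Finset.univ.sup fun k : Fin 5 =>
    if (∃ j, k ≠ j ∧ related t.p k j) ∧ ∃ j, k ≠ j ∧ related t.q k j then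
      (Finset.univ.filter fun j => k ≠ j ∧ related t.p k j).card +
        (Finset.univ.filter fun j => k ≠ j ∧ related t.q k j).card
    else 0

theorem maxStrokes_toDiagram (t : DiagramCode) : t.toDiagram.maxStrokes = t.maxStrokes := by
  have hz : ∀ k, (t.toDiagram.zStrokes.neighborSet k).ncard =
      (Finset.univ.filter fun j => k ≠ j ∧ related t.p k j).card := by
    intro k
    rw [← Set.ncard_coe_finset]
    congr 1
    ext j
    simp [zStrokes_adj]
  have hw : ∀ k, (t.toDiagram.wStrokes.neighborSet k).ncard =
      (Finset.univ.filter fun j => k ≠ j ∧ related t.q k j).card := by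
    intro k
    rw [← Set.ncard_coe_finset]
    congr 1
    ext j
    simp [wStrokes_adj]
  unfold TwoColoredDiagram.maxStrokes maxStrokes strokeCount IsBicolored
  simp only [hz, hw, zStrokes_adj, wStrokes_adj]

end DiagramCode

theorem ofCliques_eq_toDiagram {zs ws : List (Finset (Fin 5))} {cz cw : Finset (Fin 5)}
    {t : DiagramCode} (hz : ∀ j k, j ≠ k → ((∃ B ∈ zs, j ∈ B ∧ k ∈ B) ↔ related t.p j k))
    (hw : ∀ j k, j ≠ k → ((∃ B ∈ ws, j ∈ B ∧ k ∈ B) ↔ related t.q j k))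
    (hcz : ∀ k : Fin 5, k ∈ cz ↔ t.c.testBit k) (hcw : ∀ k : Fin 5, k ∈ cw ↔ t.d.testBit k) :
    ofCliques zs ws cz cw = t.toDiagram := by
  have hrel : ∀ (l : List (Finset (Fin 5))) (m : ℕ),
      (∀ j k, j ≠ k → ((∃ B ∈ l, j ∈ B ∧ k ∈ B) ↔ related m j k)) →
      (SimpleGraph.fromRel fun j k => ∃ B ∈ l, j ∈ B ∧ k ∈ B) =
        SimpleGraph.fromRel fun j k => related m j k := by
    intro l m h
    ext j k
    simp only [SimpleGraph.fromRel_adj]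
    refine and_congr_right fun hjk => ?_
    rw [h j k hjk, h k j hjk.symm]
  ext1
  · exact hrel zs t.p hz
  · exact hrel ws t.q hw
  · exact Set.ext hcz
  · exact Set.ext hcw

theorem possibleDiagrams_eq (n : ℕ) :
    possibleDiagrams n = (possibleCodes n).map DiagramCode.toDiagram := by
  rcases n with _ | _ | _ | _ | _ | _ | _ | _ | _ | n
  all_goals
    repeat refine congrArg₂ List.cons (ofCliques_eq_toDiagram (by decide +kernel)
      (by decide +kernel) (by decide +kernel) (by decide +kernel)) ?_
    rfl

theorem allPossibleDiagrams_eq :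
    allPossibleDiagrams = allPossibleCodes.map DiagramCode.toDiagram := by
  unfold allPossibleDiagrams allPossibleCodes
  rw [List.map_flatMap]
  exact List.flatMap_congr fun n _ => possibleDiagrams_eq n

theorem excludedDiagrams_eq : excludedDiagrams = excludedCodes.map DiagramCode.toDiagram := by
  unfold excludedDiagrams excludedCodes
  repeat refine congrArg₂ List.cons (ofCliques_eq_toDiagram (by decide +kernel)
    (by decide +kernel) (by decide +kernel) (by decide +kernel)) ?_
  rfl

theorem nodup_hash_mul :
    ((allPossibleCodes ++ excludedCodes).map fun t => t.hash * t.swap.hash).Nodup := by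
  decide +kernel

theorem pairwise_not_equivalent :
    (allPossibleDiagrams ++ excludedDiagrams).Pairwise fun D E => ¬ D.Equivalent E := by
  rw [allPossibleDiagrams_eq, excludedDiagrams_eq, ← List.map_append, List.pairwise_map]
  exact (List.pairwise_map.1 nodup_hash_mul).imp fun h h' =>
    h (DiagramCode.hash_mul_eq_of_equivalent h')

theorem maxStrokes_possibleCodes : ∀ n < 9, ∀ t ∈ possibleCodes n, t.maxStrokes = n := by
  decide +kernel

/-- Every equivalence relation on five vertices has a code. -/
theorem exists_related {E : Fin 5 → Fin 5 → Prop} (hE : Equivalence E) :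
    ∃ m < 1024, ∀ j k, related m j k ↔ E j k := by
  classical
  let pr : Fin 10 → Fin 5 × Fin 5 := ![(0, 1), (0, 2), (1, 2), (0, 3), (1, 3), (2, 3), (0, 4),
    (1, 4), (2, 4), (3, 4)]
  have hpr : ∀ j k : Fin 5, j < k → ∃ h : pairIndex j k < 10, pr ⟨pairIndex j k, h⟩ = (j, k) := by
    decide
  let m := Nat.ofBits fun i => decide (E (pr i).1 (pr i).2)
  have hlt : ∀ j k : Fin 5, j < k → (related m j k ↔ E j k) := by
    intro j k hjk
    obtain ⟨h, hp⟩ := hpr j k hjk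
    simp [related, hjk.ne, m, Nat.testBit_ofBits_lt _ _ h, hp]
  refine ⟨m, Nat.ofBits_lt_two_pow _, fun j k => ?_⟩
  rcases lt_trichotomy j k with h | rfl | h
  · exact hlt j k h
  · exact iff_of_true (related_self m j) (hE.refl j)
  · rw [related_comm, hlt k j h]
    exact ⟨hE.symm, hE.symm⟩

theorem exists_testBit (P : Fin 5 → Prop) : ∃ c < 32, ∀ k : Fin 5, c.testBit k ↔ P k := by
  classical
  refine ⟨Nat.ofBits fun k => decide (P k), Nat.ofBits_lt_two_pow _, fun k => ?_⟩
  rw [Nat.testBit_ofBits_lt _ _ k.isLt, decide_eq_true_iff]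

/-- The codes of nontrivial strokes belong to the list of equivalence relations. -/
theorem IsHalfLimit.exists_mem_equivalenceCodes {Γ : Fin 5 → ℝ} {Λ : ℂ} {a b : Fin 5 → ℂ}
    {A B : Fin 5 → Fin 5 → ℂ} (h : IsHalfLimit Γ Λ a b A B) (hA : ∃ j k, A j k ≠ 0) :
    ∃ m ∈ equivalenceCodes, ∀ j k, related m j k ↔ j = k ∨ A j k ≠ 0 := by
  obtain ⟨m, hm, hrel⟩ := exists_related h.equivalence
  refine ⟨m, mem_equivalenceCodes m hm (fun j k l => ?_) ?_, hrel⟩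
  · simp only [hrel]
    exact h.equivalence.trans
  · rintro rfl
    obtain ⟨j, k, hjk⟩ := hA
    have h1 := (hrel j k).2 (Or.inr hjk)
    have h2 : j = k := by simpa [related] using h1
    rw [h2, h.diag] at hjk
    exact hjk rfl

theorem IsSingularSequence.exists_equivalent {Γ : Fin 5 → ℝ} (hΓ : ∀ j, Γ j ≠ 0) {Λ : ℕ → ℂ}
    {Q : ℕ → ExtendedConfiguration 5} (hQ : IsSingularSequence Γ Λ Q) :
    ∃ t ∈ allPossibleCodes, (ofSequence Q).Equivalent t.toDiagram := by
  obtain ⟨F, hF, r, Λ₁, Λ₂, a, b, A, B, h, h', ⟨j₀, k₀, hA⟩, ⟨j₁, k₁, hB⟩, hz, hw, hcz, hcw⟩ :=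
    hQ.exists_limits
  -- renumber the vertices so that the `z`-strokes are in canonical position
  obtain ⟨m, hm, hmrel⟩ := h.isHalfLimit.exists_mem_equivalenceCodes ⟨j₀, k₀, hA⟩
  obtain ⟨p, hp, -, n₀, hn₀, hpm⟩ := exists_canonicalCode m hm
  let π : Equiv.Perm (Fin 5) := Equiv.ofBijective (digit n₀)
    (Finite.injective_iff_bijective.1 (injective_digit n₀ hn₀))
  have hprel : ∀ j k, related p j k ↔ j = k ∨ A (π j) (π k) ≠ 0 := by
    intro j k
    rw [hpm, hmrel]
    exact or_congr π.injective.eq_iff Iff.rfl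
  have hl := (h.relabel π).isHalfLimit
  have hl' := (h'.relabel π).isHalfLimit
  have hΓπ : ∀ j, (Γ ∘ π) j ≠ 0 := fun j => hΓ _
  obtain ⟨q, hq, hqrel⟩ := hl'.exists_mem_equivalenceCodes
    ⟨π.symm j₁, π.symm k₁, by simpa using hB⟩
  obtain ⟨c, hc, hcrel⟩ := exists_testBit fun k => a (π k) ≠ 0
  obtain ⟨d, hd, hdrel⟩ := exists_testBit fun k => b (π k) ≠ 0
  obtain ⟨t, ht, -, n, hn, hmatch⟩ := DiagramCode.isPossible_of_rules p hp c hc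
    (hl.circleRule hΓπ hprel hcrel) q hq (hl'.constantRule hqrel hcrel) d hd
    (hl.constantRule hprel hdrel) (hl'.circleRule hΓπ hqrel hdrel)
    (hl.classRule hl' hΓπ hprel hqrel hcrel hdrel) (hl'.classRule hl hΓπ hqrel hprel hdrel hcrel)
  have hiso : (ofSequence Q).Iso t.toDiagram := by
    have hadj : ∀ {A : Fin 5 → Fin 5 → ℂ} (j k : Fin 5), A j j = 0 →
        (A j k ≠ 0 ↔ π.symm j ≠ π.symm k ∧
          (π.symm j = π.symm k ∨ A (π (π.symm j)) (π (π.symm k)) ≠ 0)) := by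
      intro A j k hj
      rw [π.apply_symm_apply, π.apply_symm_apply, π.symm.injective.ne_iff,
        π.symm.injective.eq_iff]
      refine ⟨fun hA => ⟨?_, Or.inr hA⟩, fun hA => hA.2.resolve_left hA.1⟩
      rintro rfl
      exact hA hj
    have h1 : (ofSequence Q).Iso (DiagramCode.mk p q c d).toDiagram := by
      refine ⟨π.symm, fun j k => ?_, fun j k => ?_, fun k => ?_, fun k => ?_⟩
      · rw [hz, DiagramCode.zStrokes_adj, hprel]
        exact hadj j k (h.diag j)
      · rw [hw, DiagramCode.wStrokes_adj, hqrel]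
        exact hadj j k (h'.diag j)
      · rw [hcz]
        refine Iff.trans ?_ (hcrel (π.symm k)).symm
        rw [π.apply_symm_apply]
      · rw [hcw]
        refine Iff.trans ?_ (hdrel (π.symm k)).symm
        rw [π.apply_symm_apply]
    exact h1.trans (DiagramCode.Matches.iso (σ := Equiv.ofBijective (digit n)
      (Finite.injective_iff_bijective.1 (injective_digit n hn))) hmatch)
  rcases List.mem_append.1 ht with ht | ht
  · exact ⟨t, ht, Or.inl hiso⟩
  · obtain ⟨s, hs, rfl⟩ := List.mem_map.1 ht
    exact ⟨s, hs, Or.inr hiso.swap⟩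

end Vortex

theorem mainTheorem1 :
    -- There are 31 possible and 8 excluded diagrams, and these 39 are pairwise different.
    Vortex.allPossibleDiagrams.length = 31 ∧
    Vortex.excludedDiagrams.length = 8 ∧
    (Vortex.allPossibleDiagrams ++ Vortex.excludedDiagrams).Pairwise
      (fun D E => ¬ D.Equivalent E) ∧
    -- The diagram of any singular sequence is a possible one, and it is not an excluded one.
    ∀ (Γ : Fin 5 → ℝ), (∀ j, Γ j ≠ 0) →
      ∀ (Λ : ℕ → ℂ) (Q : ℕ → Vortex.ExtendedConfiguration 5),
        Vortex.IsSingularSequence Γ Λ Q →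
        (∃ D ∈ Vortex.possibleDiagrams (Vortex.TwoColoredDiagram.ofSequence Q).maxStrokes,
          (Vortex.TwoColoredDiagram.ofSequence Q).Equivalent D) ∧
        (∃ D ∈ Vortex.allPossibleDiagrams,
          (Vortex.TwoColoredDiagram.ofSequence Q).Equivalent D) ∧
        ∀ E ∈ Vortex.excludedDiagrams,
          ¬ (Vortex.TwoColoredDiagram.ofSequence Q).Equivalent E := by
  refine ⟨rfl, rfl, Vortex.pairwise_not_equivalent, fun Γ hΓ Λ Q hQ => ?_⟩
  obtain ⟨t, ht, hequiv⟩ := hQ.exists_equivalent hΓ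
  obtain ⟨n, hn, htn⟩ := List.mem_flatMap.1 ht
  have hall : t.toDiagram ∈ Vortex.allPossibleDiagrams := by
    rw [Vortex.allPossibleDiagrams_eq]
    exact List.mem_map_of_mem ht
  refine ⟨⟨t.toDiagram, ?_, hequiv⟩, ⟨t.toDiagram, hall, hequiv⟩, fun E hE hQE => ?_⟩
  · rw [hequiv.maxStrokes_eq, t.maxStrokes_toDiagram,
      Vortex.maxStrokes_possibleCodes n (List.mem_range.1 hn) t htn, Vortex.possibleDiagrams_eq]
    exact List.mem_map_of_mem htn
  · exact (List.pairwise_append.1 Vortex.pairwise_not_equivalent).2.2 _ hall E hE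
      (hequiv.symm.trans hQE)
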